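/- **Theorem 1.** For positive integers $q_{ij}$ and integers $p_{ij}$ ($1\le i\le N$, $1\le j\le p$) put $d_0=\prod_{i,j}q_{ij}$. Let $h:\mathbb R^p\to\mathbb R^q$, $h(x)=W_2\,\sigma(W_1x+b_1)+b_2$, be a network with one hidden layer of $N$ neurons, where $\sigma(t)=1/(1+e^{-t})$ acts on each coordinate, $[W_1]_{ij}=p_{ij}/q_{ij}$, and the entries of $W_2$ and $b_2$ are real algebraic numbers (for instance rational numbers). Let $I_y=[\alpha_1,\beta_1]\times\dots\times[\alpha_p,\beta_p]$ with $\alpha_j,\beta_j\in\mathbb R$, and let $\psi(u)$, $u=(u_1,\dots,u_q)$, be a first-order formula over $(\mathbb R,<,+,-,\cdot,0,1)$. Suppose that $e^{b_1^i}$, $e^{\alpha_j/d_0}$ and $e^{\beta_j/d_0}$ are rational for all $1\le i\le N$ and $1\le j\le p$, where $b_1^i$ is the $i$-th coordinate of $b_1$. Then it is decidable whether $$\forall u\in\mathbb R^q:\quad \bigl(\exists y\in I_y:\ u=h(y)\bigr)\ \Rightarrow\ \psi(u).$$ That is, a single algorithm, given $p,N,q$, the integers $p_{ij},q_{ij}$,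 the rational numbers $e^{b_1^i},e^{\alpha_j/d_0},e^{\beta_j/d_0}$, the entries of $W_2$ and $b_2$ (each given by a nonzero integer polynomial and a rational interval in which it is the only root) and the formula $\psi$, always halts and answers correctly whether this property holds. -/

import Mathlib

namespace SigmoidVerification

/-! ### First-order formulas over `(ℝ, <, +, -, ·, 0, 1)` -/

/-- The function symbols `0`, `1` (constants) and `+`, `-`, `·` (binary). -/
inductive RFun : ℕ → Type
  | zero : RFun 0
  | one : RFun 0
  | add : RFun 2
  | sub : RFun 2
  | mul : RFun 2

/-- The only relation symbol (besides equality, which is part of the logic) is `<`. -/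
inductive RRel : ℕ → Type
  | lt : RRel 2

/-- The first-order language with signature `(<, +, -, ·, 0, 1)`. -/
abbrev RLang : FirstOrder.Language.{0, 0} where
  Functions := RFun
  Relations := RRel

/-- The real numbers with the standard interpretation of the symbols. -/
noncomputable instance realStructure : RLang.Structure ℝ where
  funMap f x :=
    match f with
    | .zero => 0
    | .one => 1
    | .add => x 0 + x 1
    | .sub => x 0 - x 1
    | .mul => x 0 * x 1
  RelMap r x :=
    match r with
    | .lt => x 0 < x 1

/-- Gödel numbers of terms, for a given numbering `v` of the variables. -/
def termCode {V : Type} (v : V → ℕ) : RLang.Term V → ℕ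
  | .var x => Nat.pair 0 (v x)
  | .func RFun.zero _ => Nat.pair 1 0
  | .func RFun.one _ => Nat.pair 2 0
  | .func RFun.add t => Nat.pair 3 (Nat.pair (termCode v (t 0)) (termCode v (t 1)))
  | .func RFun.sub t => Nat.pair 4 (Nat.pair (termCode v (t 0)) (termCode v (t 1)))
  | .func RFun.mul t => Nat.pair 5 (Nat.pair (termCode v (t 0)) (termCode v (t 1)))

/-- Numbering of variables: the free variable `u_i` gets `2 i`, and the variable bound by the
quantifier at depth `k` gets `2 k + 1`. -/
def varCode {q n : ℕ} : Fin q ⊕ Fin n → ℕ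
  | .inl i => 2 * i
  | .inr k => 2 * k + 1

/-- Gödel numbers of first-order formulas with free variables `u_0, …, u_{q-1}`. -/
def formulaCode {q : ℕ} : {n : ℕ} → RLang.BoundedFormula (Fin q) n → ℕ
  | _, .falsum => Nat.pair 0 0
  | _, .equal s t => Nat.pair 1 (Nat.pair (termCode varCode s) (termCode varCode t))
  | _, .rel RRel.lt t =>
      Nat.pair 2 (Nat.pair (termCode varCode (t 0)) (termCode varCode (t 1)))
  | _, .imp φ χ => Nat.pair 3 (Nat.pair (formulaCode φ) (formulaCode χ))
  | _, .all φ => Nat.pair 4 (formulaCode φ)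

/-! ### Sigmoid networks with one hidden layer -/

/-- The (real) parameters of a network `ℝ^p → ℝ^q` with one hidden layer of `N` neurons. -/
structure SigmoidNetwork (p N q : ℕ) where
  W₁ : Matrix (Fin N) (Fin p) ℝ
  b₁ : Fin N → ℝ
  W₂ : Matrix (Fin q) (Fin N) ℝ
  b₂ : Fin q → ℝ

open Matrix in
/-- The function `h(x) = W₂ σ(W₁ x + b₁) + b₂`, where `σ(t) = 1 / (1 + e^{-t})` is applied to
each coordinate. -/
noncomputable def SigmoidNetwork.eval {p N q : ℕ} (h : SigmoidNetwork p N q)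
    (x : Fin p → ℝ) : Fin q → ℝ :=
  h.W₂ *ᵥ (fun i => Real.sigmoid ((h.W₁ *ᵥ x + h.b₁) i)) + h.b₂

/-! ### Finite descriptions of the input data -/

/-- The product `d₀` of all the denominators. -/
def denomProd {p N : ℕ} (Q : Matrix (Fin N) (Fin p) ℕ) : ℕ := ∏ i, ∏ j, Q i j

/-- Data describing a real algebraic number: an integer polynomial and a rational interval
`[lo, hi]`. -/
structure AlgebraicDescription where
  poly : Polynomial ℤ
  lo : ℚ
  hi : ℚ

/-- `a` describes `x` if the polynomial is nonzero and `x` is its only root in `[lo, hi]`. -/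
def AlgebraicDescription.Describes (a : AlgebraicDescription) (x : ℝ) : Prop :=
  a.poly ≠ 0 ∧ ∀ y : ℝ, (((a.lo : ℝ) ≤ y ∧ y ≤ (a.hi : ℝ)) ∧ Polynomial.aeval y a.poly = 0) ↔ y = x

/-- Rationals are handed to an algorithm as pairs (numerator, denominator). -/
abbrev RatCode := ℤ × ℕ

def ratCode (r : ℚ) : RatCode := (r.num, r.den)

/-- Real algebraic numbers are handed to an algorithm as the list of the coefficients of the
polynomial, in increasing degree, together with the end points of the interval. -/
abbrev AlgebraicCode := List ℤ × RatCode × RatCode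

noncomputable def AlgebraicDescription.code (a : AlgebraicDescription) : AlgebraicCode :=
  ((List.range (a.poly.natDegree + 1)).map a.poly.coeff, ratCode a.lo, ratCode a.hi)

/-- The inputs of a decision procedure: `(p, N, q)`; the fractions `p_ij / q_ij` row by row; the
lists of the numbers `e^{b₁ⁱ}`, `e^{α_j/d₀}`, `e^{β_j/d₀}`; the rows of `W₂`; `b₂`; the Gödel
number of the output property. -/
abbrev InstanceCode :=
  (ℕ × ℕ × ℕ) × List (List (ℤ × ℕ)) × List RatCode × List RatCode × List RatCode ×
    List (List AlgebraicCode) × List AlgebraicCode × ℕ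

noncomputable def instanceCode {p N q : ℕ}
    (P : Matrix (Fin N) (Fin p) ℤ) (Q : Matrix (Fin N) (Fin p) ℕ)
    (expb₁ : Fin N → ℚ) (expα expβ : Fin p → ℚ)
    (w₂ : Matrix (Fin q) (Fin N) AlgebraicDescription) (c₂ : Fin q → AlgebraicDescription)
    (ψ : RLang.Formula (Fin q)) : InstanceCode :=
  ((p, N, q),
    List.ofFn (fun i => List.ofFn fun j => (P i j, Q i j)),
    List.ofFn (fun i => ratCode (expb₁ i)),
    List.ofFn (fun j => ratCode (expα j)),
    List.ofFn (fun j => ratCode (expβ j)),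
    List.ofFn (fun k => List.ofFn fun i => (w₂ k i).code),
    List.ofFn (fun k => (c₂ k).code),
    formulaCode ψ)

end SigmoidVerification

namespace SigmoidVerification

/-! ### Primitive recursion, set up for `fun_prop` -/

attribute [fun_prop] Primrec

instance : Primcodable SignType := Primcodable.ofEquiv (Fin 3) SignType.fin3Equiv.toEquiv

section PrimrecRules

variable {α β γ : Type} [Primcodable α] [Primcodable β] [Primcodable γ]

namespace PrimrecRules

@[fun_prop]
theorem id : Primrec fun a : α => a := Primrec.id

@[fun_prop]
theorem const (b : β) : Primrec fun _ : α => b := Primrec.const b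

@[fun_prop]
theorem comp {f : β → γ} {g : α → β} (hf : Primrec f) (hg : Primrec g) :
    Primrec fun a => f (g a) := hf.comp hg

@[fun_prop]
theorem fst {f : α → β × γ} (hf : Primrec f) : Primrec fun a => (f a).1 := Primrec.fst.comp hf

@[fun_prop]
theorem snd {f : α → β × γ} (hf : Primrec f) : Primrec fun a => (f a).2 := Primrec.snd.comp hf

@[fun_prop]
theorem mk {f : α → β} {g : α → γ} (hf : Primrec f) (hg : Primrec g) :
    Primrec fun a => (f a, g a) := hf.pair hg

@[fun_prop]
theorem map {f : α → List β} {g : α → β → γ} (hf : Primrec f)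
    (hg : Primrec fun x : α × β => g x.1 x.2) : Primrec fun a => (f a).map (g a) :=
  Primrec.list_map hf hg

@[fun_prop]
theorem flatMap {f : α → List β} {g : α → β → List γ} (hf : Primrec f)
    (hg : Primrec fun x : α × β => g x.1 x.2) : Primrec fun a => (f a).flatMap (g a) :=
  Primrec.list_flatMap hf hg

@[fun_prop]
theorem foldl {f : α → List β} {g : α → γ} {h : α → γ → β → γ} (hf : Primrec f) (hg : Primrec g)
    (hh : Primrec fun x : α × γ × β => h x.1 x.2.1 x.2.2) :
    Primrec fun a => (f a).foldl (h a) (g a) :=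
  Primrec.list_foldl (h := fun a s => h a s.1 s.2) hf hg hh

@[fun_prop]
theorem foldr {f : α → List β} {g : α → γ} {h : α → β → γ → γ} (hf : Primrec f) (hg : Primrec g)
    (hh : Primrec fun x : α × β × γ => h x.1 x.2.1 x.2.2) :
    Primrec fun a => (f a).foldr (h a) (g a) :=
  Primrec.list_foldr (h := fun a s => h a s.1 s.2) hf hg hh

@[fun_prop]
theorem cons {f : α → β} {g : α → List β} (hf : Primrec f) (hg : Primrec g) :
    Primrec fun a => f a :: g a := Primrec.list_cons.comp hf hg

@[fun_prop]
theorem append {f g : α → List β} (hf : Primrec f) (hg : Primrec g) :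
    Primrec fun a => f a ++ g a := Primrec.list_append.comp hf hg

@[fun_prop]
theorem tail {f : α → List β} (hf : Primrec f) : Primrec fun a => (f a).tail :=
  Primrec.list_tail.comp hf

@[fun_prop]
theorem headI [Inhabited β] {f : α → List β} (hf : Primrec f) : Primrec fun a => (f a).headI :=
  Primrec.list_headI.comp hf

@[fun_prop]
theorem length {f : α → List β} (hf : Primrec f) : Primrec fun a => (f a).length :=
  Primrec.list_length.comp hf

@[fun_prop]
theorem reverse {f : α → List β} (hf : Primrec f) : Primrec fun a => (f a).reverse :=
  Primrec.list_reverse.comp hf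

@[fun_prop]
theorem flatten {f : α → List (List β)} (hf : Primrec f) : Primrec fun a => (f a).flatten :=
  Primrec.list_flatten.comp hf

@[fun_prop]
theorem range {f : α → ℕ} (hf : Primrec f) : Primrec fun a => List.range (f a) :=
  Primrec.list_range.comp hf

@[fun_prop]
theorem take {f : α → ℕ} {g : α → List β} (hf : Primrec f) (hg : Primrec g) :
    Primrec fun a => (g a).take (f a) := Primrec.list_take.comp hf hg

@[fun_prop]
theorem drop {f : α → ℕ} {g : α → List β} (hf : Primrec f) (hg : Primrec g) :
    Primrec fun a => (g a).drop (f a) := Primrec.list_drop.comp hf hg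

@[fun_prop]
theorem getD {f : α → List β} {g : α → ℕ} (d : β) (hf : Primrec f) (hg : Primrec g) :
    Primrec fun a => (f a).getD (g a) d := (Primrec.list_getD d).comp hf hg

@[fun_prop]
theorem idxOf [i : BEq β] [LawfulBEq β] {f : α → List β} {g : α → β} (hf : Primrec f)
    (hg : Primrec g) : Primrec fun a => (f a).idxOf (g a) := by
  have : DecidableEq β := Encodable.decidableEqOfEncodable β
  obtain rfl := lawful_beq_subsingleton i instBEqOfDecidableEq
  exact Primrec.list_idxOf.comp hg hf

@[fun_prop]
theorem lookup [i : BEq β] [LawfulBEq β] {f : α → List (β × γ)} {g : α → β} (hf : Primrec f)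
    (hg : Primrec g) : Primrec fun a => (f a).lookup (g a) := by
  have : DecidableEq β := Encodable.decidableEqOfEncodable β
  obtain rfl := lawful_beq_subsingleton i instBEqOfDecidableEq
  exact Primrec.listLookup.comp hg hf

@[fun_prop]
theorem optionGetD {f : α → Option β} {g : α → β} (hf : Primrec f) (hg : Primrec g) :
    Primrec fun a => (f a).getD (g a) := Primrec.option_getD.comp hf hg

@[fun_prop]
theorem getLastD {f : α → List β} {g : α → β} (hf : Primrec f) (hg : Primrec g) :
    Primrec fun a => (f a).getLastD (g a) :=
  (Primrec.option_getD.comp (Primrec.list_head?.comp (Primrec.list_reverse.comp hf)) hg).of_eq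
    fun a => by simp [List.getLastD_eq_getLast?]

@[fun_prop]
theorem ite {p : α → Prop} [DecidablePred p] {f g : α → β} (hp : Primrec fun a => decide (p a))
    (hf : Primrec f) (hg : Primrec g) : Primrec fun a => if p a then f a else g a :=
  Primrec.ite (Primrec.primrecPred hp) hf hg

@[fun_prop]
theorem filter {f : α → List β} {g : α → β → Bool} (hf : Primrec f)
    (hg : Primrec fun x : α × β => g x.1 x.2) : Primrec fun a => (f a).filter (g a) := by
  have : Primrec fun a => (f a).flatMap fun b => if g a b = true then [b] else [] :=
    Primrec.list_flatMap hf (Primrec.ite (Primrec.primrecPred (hg.of_eq fun x => by simp))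
      (Primrec.list_cons.comp Primrec.snd (Primrec.const _)) (Primrec.const _))
  refine this.of_eq fun a => ?_
  induction f a with
  | nil => rfl
  | cons b l ih => by_cases h : g a b <;> simp_all

@[fun_prop]
theorem decide_eq [DecidableEq β] {f g : α → β} (hf : Primrec f) (hg : Primrec g) :
    Primrec fun a => decide (f a = g a) := (Primrec.eq.comp hf hg).decide

@[fun_prop]
theorem decide_le {f g : α → ℕ} (hf : Primrec f) (hg : Primrec g) :
    Primrec fun a => decide (f a ≤ g a) := (Primrec.nat_le.comp hf hg).decide

@[fun_prop]
theorem decide_and {p q : α → Prop} [DecidablePred p] [DecidablePred q]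
    (hp : Primrec fun a => decide (p a)) (hq : Primrec fun a => decide (q a)) :
    Primrec fun a => decide (p a ∧ q a) :=
  ((Primrec.primrecPred hp).and (Primrec.primrecPred hq)).decide

@[fun_prop]
theorem decide_or {p q : α → Prop} [DecidablePred p] [DecidablePred q]
    (hp : Primrec fun a => decide (p a)) (hq : Primrec fun a => decide (q a)) :
    Primrec fun a => decide (p a ∨ q a) :=
  ((Primrec.primrecPred hp).or (Primrec.primrecPred hq)).decide

@[fun_prop]
theorem decide_not {p : α → Prop} [DecidablePred p] (hp : Primrec fun a => decide (p a)) :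
    Primrec fun a => decide (¬ p a) := (Primrec.primrecPred hp).not.decide

@[fun_prop]
theorem decide_mem {f : α → List β} {g : α → β} [∀ a, Decidable (g a ∈ f a)] (hf : Primrec f)
    (hg : Primrec g) : Primrec fun a => decide (g a ∈ f a) := by
  have : DecidableEq β := Encodable.decidableEqOfEncodable β
  refine (Primrec.nat_lt.comp (Primrec.list_idxOf.comp hg hf)
    (Primrec.list_length.comp hf)).decide.of_eq fun a => ?_
  simp [List.idxOf_lt_length_iff]

@[fun_prop]
theorem decide_forall_mem {f : α → List β} {p : α → β → Prop} [∀ a b, Decidable (p a b)]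
    (hf : Primrec f) (hp : Primrec fun x : α × β => decide (p x.1 x.2)) :
    Primrec fun a => decide (∀ b ∈ f a, p a b) := by
  have : Primrec fun a => decide (((f a).filter fun b => !decide (p a b)).length = 0) :=
    decide_eq (length (filter (g := fun a b => !decide (p a b)) hf (Primrec.not.comp hp))) (const 0)
  refine this.of_eq fun a => ?_
  simp [List.filter_eq_nil_iff]

@[fun_prop]
theorem add {f g : α → ℕ} (hf : Primrec f) (hg : Primrec g) : Primrec fun a => f a + g a :=
  Primrec.nat_add.comp hf hg

@[fun_prop]
theorem sub {f g : α → ℕ} (hf : Primrec f) (hg : Primrec g) : Primrec fun a => f a - g a :=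
  Primrec.nat_sub.comp hf hg

@[fun_prop]
theorem mul {f g : α → ℕ} (hf : Primrec f) (hg : Primrec g) : Primrec fun a => f a * g a :=
  Primrec.nat_mul.comp hf hg

@[fun_prop]
theorem div {f g : α → ℕ} (hf : Primrec f) (hg : Primrec g) : Primrec fun a => f a / g a :=
  Primrec.nat_div.comp hf hg

@[fun_prop]
theorem mod {f g : α → ℕ} (hf : Primrec f) (hg : Primrec g) : Primrec fun a => f a % g a :=
  Primrec.nat_mod.comp hf hg

@[fun_prop]
theorem unpair {f : α → ℕ} (hf : Primrec f) : Primrec fun a => (f a).unpair :=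
  Primrec.unpair.comp hf

@[fun_prop]
theorem not {f : α → Bool} (hf : Primrec f) : Primrec fun a => !f a := Primrec.not.comp hf

@[fun_prop]
theorem xor {f g : α → Bool} (hf : Primrec f) (hg : Primrec g) : Primrec fun a => f a ^^ g a :=
  (Primrec.dom_bool₂ _).comp hf hg

@[fun_prop]
theorem neg_sign {f : α → SignType} (hf : Primrec f) : Primrec fun a => -f a :=
  (Primrec.dom_finite fun s : SignType => -s).comp hf

@[fun_prop]
theorem iterate {f : α → ℕ} {g : α → β} {h : α → β → β} (hf : Primrec f) (hg : Primrec g)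
    (hh : Primrec fun x : α × β => h x.1 x.2) : Primrec fun a => (h a)^[f a] (g a) :=
  Primrec.nat_iterate hf hg hh

@[fun_prop]
theorem encode {f : α → β} (hf : Primrec f) : Primrec fun a => Encodable.encode (f a) :=
  Primrec.encode.comp hf

@[fun_prop]
theorem int_toNat {f : α → ℤ} (hf : Primrec f) : Primrec fun a => (f a).toNat := by
  have : Primrec fun a => if Encodable.encode (f a) % 2 = 0 then Encodable.encode (f a) / 2 else 0 := by
    fun_prop
  refine this.of_eq fun a => ?_
  rcases f a with n | n
  · change (if (2 * n) % 2 = 0 then (2 * n) / 2 else 0) = n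
    simp
  · change (if (2 * n + 1) % 2 = 0 then (2 * n + 1) / 2 else 0) = 0
    rw [if_neg (by omega)]

@[fun_prop]
theorem int_neg_toNat {f : α → ℤ} (hf : Primrec f) : Primrec fun a => (-f a).toNat := by
  have : Primrec fun a => if Encodable.encode (f a) % 2 = 0 then 0
      else Encodable.encode (f a) / 2 + 1 := by
    fun_prop
  refine this.of_eq fun a => ?_
  rcases f a with n | n
  · change (if (2 * n) % 2 = 0 then 0 else (2 * n) / 2 + 1) = (-(n : ℤ)).toNat
    simp
  · change (if (2 * n + 1) % 2 = 0 then 0 else (2 * n + 1) / 2 + 1) = n + 1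
    rw [if_neg (by omega)]
    omega

end PrimrecRules

end PrimrecRules

/-! ### Multivariate integer polynomials -/

/-- Integer polynomials as lists of signed monomials: `(b, [i, j, …])` stands for `± x_i x_j ⋯`,
with the negative sign if `b` is true. -/
abbrev MPoly := List (Bool × List ℕ)

namespace MPoly

/-- The value of a polynomial. -/
noncomputable def eval (v : ℕ → ℝ) (p : MPoly) : ℝ :=
  (p.map fun m => (if m.1 then -1 else 1) * (m.2.map v).prod).sum

def neg (p : MPoly) : MPoly := p.map fun m => (!m.1, m.2)

def sub (p q : MPoly) : MPoly := p ++ neg q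

def mul (p q : MPoly) : MPoly := p.flatMap fun m => q.map fun n => (m.1 ^^ n.1, m.2 ++ n.2)

def smul (n : ℕ) (p : MPoly) : MPoly := (List.range n).flatMap fun _ => p

def var (i : ℕ) : MPoly := [(false, [i])]

def nat (n : ℕ) : MPoly := smul n [(false, [])]

def int (z : ℤ) : MPoly := sub (nat z.toNat) (nat (-z).toNat)

def pow (p : MPoly) (n : ℕ) : MPoly := (mul p)^[n] (nat 1)

def sum (l : List MPoly) : MPoly := l.flatten

def prod (l : List MPoly) : MPoly := l.foldr mul (nat 1)

/-- The coefficient of `x_0 ^ i`, with the remaining variables renumbered. -/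
def coeff (i : ℕ) (p : MPoly) : MPoly :=
  (p.filter fun m => decide ((m.2.filter fun k => decide (k = 0)).length = i)).map fun m =>
    (m.1, (m.2.filter fun k => decide (¬ k = 0)).map fun k => k - 1)

/-- The sign at the point all of whose coordinates are `1`. -/
def signAtOne (p : MPoly) : SignType :=
  if (p.filter fun m => m.1).length = (p.filter fun m => !m.1).length then 0
  else if (p.filter fun m => m.1).length ≤ (p.filter fun m => !m.1).length then 1 else -1

section Eval

variable (v : ℕ → ℝ) (p q : MPoly)

@[simp]
theorem eval_nil : eval v [] = 0 := by simp [eval]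

theorem eval_cons (m : Bool × List ℕ) :
    eval v (m :: p) = (if m.1 then -1 else 1) * (m.2.map v).prod + eval v p := by
  simp [eval]

@[simp]
theorem eval_append : eval v (p ++ q) = eval v p + eval v q := by simp [eval]

@[simp]
theorem eval_neg : eval v (neg p) = -eval v p := by
  induction p with
  | nil => simp [neg]
  | cons m p ih =>
    have : neg (m :: p) = (!m.1, m.2) :: neg p := rfl
    rw [this, eval_cons, eval_cons, ih]
    cases m.1 <;> simp <;> ring

@[simp]
theorem eval_sub : eval v (sub p q) = eval v p - eval v q := by simp [sub, sub_eq_add_neg]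

theorem eval_map_mul (m : Bool × List ℕ) :
    eval v (q.map fun n => (m.1 ^^ n.1, m.2 ++ n.2)) =
      (if m.1 then -1 else 1) * (m.2.map v).prod * eval v q := by
  induction q with
  | nil => simp
  | cons n q ih =>
    rw [List.map_cons, eval_cons, eval_cons, ih]
    cases m.1 <;> cases n.1 <;> simp <;> ring

@[simp]
theorem eval_mul : eval v (mul p q) = eval v p * eval v q := by
  induction p with
  | nil => simp [mul]
  | cons m p ih =>
    have : mul (m :: p) q = (q.map fun n => (m.1 ^^ n.1, m.2 ++ n.2)) ++ mul p q := rfl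
    rw [this, eval_append, eval_map_mul, ih, eval_cons]
    ring

@[simp]
theorem eval_smul (n : ℕ) : eval v (smul n p) = n * eval v p := by
  induction n with
  | zero => simp [smul]
  | succ n ih =>
    have : smul (n + 1) p = smul n p ++ p := by simp [smul, List.range_succ]
    rw [this, eval_append, ih]
    push_cast
    ring

@[simp]
theorem eval_var (i : ℕ) : eval v (var i) = v i := by simp [var, eval]

@[simp]
theorem eval_nat (n : ℕ) : eval v (nat n) = n := by simp [nat, eval_cons]

@[simp]
theorem eval_int (z : ℤ) : eval v (int z) = z := by
  have : ((z.toNat : ℤ) : ℝ) - ((-z).toNat : ℤ) = z := by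
    rw [← Int.cast_sub, Int.toNat_sub_toNat_neg]
  rw [Int.cast_natCast, Int.cast_natCast] at this
  rw [int, eval_sub, eval_nat, eval_nat, this]

@[simp]
theorem eval_pow (n : ℕ) : eval v (pow p n) = eval v p ^ n := by
  induction n with
  | zero => simp [pow]
  | succ n ih =>
    have : pow p (n + 1) = mul p (pow p n) := Function.iterate_succ_apply' _ _ _
    rw [this, eval_mul, ih, pow_succ']

@[simp]
theorem eval_sum (l : List MPoly) : eval v (sum l) = (l.map (eval v)).sum := by
  induction l with
  | nil => simp [sum]
  | cons p l ih => simpa [sum] using ih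

@[simp]
theorem eval_prod (l : List MPoly) : eval v (prod l) = (l.map (eval v)).prod := by
  induction l with
  | nil => simp [prod]
  | cons p l ih => simpa [prod] using Or.inl ih

/-- The assignment with the new value `x` for the variable `0`. -/
def push (x : ℝ) (v : ℕ → ℝ) : ℕ → ℝ
  | 0 => x
  | n + 1 => v n

theorem prod_map_push (x : ℝ) (l : List ℕ) :
    (l.map (push x v)).prod = x ^ (l.filter fun k => decide (k = 0)).length *
      (((l.filter fun k => decide (¬ k = 0)).map fun k => k - 1).map v).prod := by
  induction l with
  | nil => simp
  | cons k l ih =>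
    rw [List.map_cons, List.prod_cons, ih]
    cases k with
    | zero => simp [push, pow_succ]; ring
    | succ k => simp [push]; ring

theorem sum_coeff (x : ℝ) (d : ℕ)
    (hd : ∀ m ∈ p, (m.2.filter fun k => decide (k = 0)).length ≤ d) :
    ∑ i ∈ Finset.range (d + 1), eval v (coeff i p) * x ^ i = eval (push x v) p := by
  induction p with
  | nil => simp [coeff]
  | cons m p ih =>
    rw [eval_cons, ← ih fun n hn => hd n (List.mem_cons_of_mem _ hn), prod_map_push]
    have hm := hd m List.mem_cons_self
    set e := (m.2.filter fun k => decide (k = 0)).length with he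
    have : ∀ i, eval v (coeff i (m :: p)) * x ^ i = eval v (coeff i p) * x ^ i +
        if e = i then (if m.1 then -1 else 1) * (x ^ e *
          (((m.2.filter fun k => decide (¬ k = 0)).map fun k => k - 1).map v).prod) else 0 := by
      intro i
      by_cases h : e = i
      · have : coeff i (m :: p) =
            (m.1, (m.2.filter fun k => decide (¬ k = 0)).map fun k => k - 1) :: coeff i p := by
          simp only [coeff]
          rw [List.filter_cons_of_pos (by simp [← he, h]), List.map_cons]
        rw [this, eval_cons, if_pos h, ← h]
        ring
      · have : coeff i (m :: p) = coeff i p := by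
          rw [coeff, List.filter_cons_of_neg (by simp [← he, h]), coeff]
        rw [this, if_neg h, add_zero]
    rw [Finset.sum_congr rfl fun i _ => this i, Finset.sum_add_distrib, Finset.sum_ite_eq,
      if_pos (by simp; omega)]
    ring

theorem sign_eval_one : SignType.sign (eval (fun _ => 1) p) = signAtOne p := by
  have : eval (fun _ => 1) p =
      ((p.filter fun m => !m.1).length : ℝ) - (p.filter fun m => m.1).length := by
    induction p with
    | nil => simp
    | cons m p ih =>
      rw [eval_cons, ih]
      cases h : m.1 <;> simp [h] <;> ring
  rw [this, signAtOne]
  split_ifs with h₁ h₂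
  · simp [h₁]
  · exact sign_pos (sub_pos.2 (by exact_mod_cast lt_of_le_of_ne h₂ h₁))
  · exact sign_neg (sub_neg.2 (by exact_mod_cast not_le.1 h₂))

end Eval

section Primrec

variable {α : Type} [Primcodable α] {f g : α → MPoly} {n : α → ℕ}

@[fun_prop]
theorem neg_primrec (hf : Primrec f) : Primrec fun a => neg (f a) := by
  unfold neg; fun_prop

@[fun_prop]
theorem sub_primrec (hf : Primrec f) (hg : Primrec g) : Primrec fun a => sub (f a) (g a) := by
  unfold sub; fun_prop

@[fun_prop]
theorem mul_primrec (hf : Primrec f) (hg : Primrec g) : Primrec fun a => mul (f a) (g a) := by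
  unfold mul; fun_prop

@[fun_prop]
theorem smul_primrec (hn : Primrec n) (hf : Primrec f) : Primrec fun a => smul (n a) (f a) := by
  unfold smul; fun_prop

@[fun_prop]
theorem var_primrec (hn : Primrec n) : Primrec fun a => var (n a) := by
  unfold var; fun_prop

@[fun_prop]
theorem nat_primrec (hn : Primrec n) : Primrec fun a => nat (n a) := by
  unfold nat; fun_prop

@[fun_prop]
theorem int_primrec {z : α → ℤ} (hz : Primrec z) : Primrec fun a => int (z a) := by
  unfold int; fun_prop

@[fun_prop]
theorem pow_primrec (hf : Primrec f) (hn : Primrec n) : Primrec fun a => pow (f a) (n a) := by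
  unfold pow; fun_prop

@[fun_prop]
theorem sum_primrec {l : α → List MPoly} (hl : Primrec l) : Primrec fun a => sum (l a) := by
  unfold sum; fun_prop

@[fun_prop]
theorem prod_primrec {l : α → List MPoly} (hl : Primrec l) : Primrec fun a => prod (l a) := by
  unfold prod; fun_prop

@[fun_prop]
theorem coeff_primrec (hn : Primrec n) (hf : Primrec f) : Primrec fun a => coeff (n a) (f a) := by
  unfold coeff; fun_prop

@[fun_prop]
theorem signAtOne_primrec (hf : Primrec f) : Primrec fun a => signAtOne (f a) := by
  unfold signAtOne; fun_prop

end Primrec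

end MPoly

/-! ### Univariate polynomials with symbolic coefficients -/

/-- Polynomials in one variable with coefficients in `MPoly`, the leading coefficient first. -/
abbrev UPoly := List MPoly

namespace UPoly

open Polynomial

/-- The real polynomial obtained by evaluating the coefficients. -/
noncomputable def toReal (v : ℕ → ℝ) : UPoly → ℝ[X]
  | [] => 0
  | a :: p => C (a.eval v) * X ^ p.length + toReal v p

/-- A polynomial, viewed as a polynomial in the variable `0`. -/
def ofMPoly (p : MPoly) : UPoly :=
  (List.range ((p.flatMap fun m => m.2).length + 1)).reverse.map fun i => p.coeff i

def deriv (p : UPoly) : UPoly :=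
  (List.range (p.length - 1)).map fun i => MPoly.smul (p.length - 1 - i) (p.getD i [])

/-- One step of the division of `p` by `q`, scaled by the square of the leading coefficient
of `q`. -/
def remStep (q p : UPoly) : UPoly :=
  (List.range (p.length - 1)).map fun i =>
    MPoly.sub (MPoly.mul (MPoly.mul q.headI q.headI) (p.tail.getD i []))
      (MPoly.mul (MPoly.mul q.headI p.headI) (q.tail.getD i []))

/-- The remainder of `p` modulo `q`, up to a positive factor. -/
def rem (p q : UPoly) : UPoly := (remStep q)^[p.length + 1 - q.length] p

theorem toReal_map_range (v : ℕ → ℝ) (f : ℕ → MPoly) (n : ℕ) :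
    toReal v ((List.range n).map f) =
      ∑ i ∈ Finset.range n, C ((f i).eval v) * X ^ (n - 1 - i) := by
  induction n generalizing f with
  | zero => simp [toReal]
  | succ n ih =>
    rw [List.range_succ_eq_map, List.map_cons, toReal, List.map_map, ih, Finset.sum_range_succ',
      add_comm]
    congr 1
    · refine Finset.sum_congr rfl fun i hi => ?_
      congr 2
      have := Finset.mem_range.1 hi
      omega
    · simp

theorem toReal_eq_sum (v : ℕ → ℝ) (p : UPoly) :
    toReal v p = ∑ i ∈ Finset.range p.length, C ((p.getD i []).eval v) * X ^ (p.length - 1 - i) := by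
  rw [← toReal_map_range]
  congr 1
  refine List.ext_getElem (by simp) fun i h₁ h₂ => ?_
  simp [h₁]

theorem toReal_mul_X_pow (v : ℕ → ℝ) (p : UPoly) (n : ℕ) (h : p.length ≤ n) :
    toReal v p * X ^ (n - p.length) =
      ∑ i ∈ Finset.range n, C ((p.getD i []).eval v) * X ^ (n - 1 - i) := by
  obtain ⟨k, rfl⟩ := Nat.exists_eq_add_of_le h
  rw [Finset.sum_range_add, toReal_eq_sum, Finset.sum_mul, Finset.sum_eq_zero (s := .range k),
    add_zero]
  · refine Finset.sum_congr rfl fun i hi => ?_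
    have := Finset.mem_range.1 hi
    rw [mul_assoc, ← pow_add]
    congr 2
    omega
  · intro i _
    simp

theorem eval_ofMPoly (v : ℕ → ℝ) (p : MPoly) (x : ℝ) :
    (toReal v (ofMPoly p)).eval x = p.eval (MPoly.push x v) := by
  set d := (p.flatMap fun m => m.2).length with hd
  rw [← MPoly.sum_coeff v p x d, ofMPoly, ← hd, ← Finset.sum_range_reflect]
  · have : (List.range (d + 1)).reverse = (List.range (d + 1)).map fun i => d - i := by
      refine List.ext_getElem (by simp) fun i h₁ h₂ => ?_
      simp
    rw [this, List.map_map, toReal_map_range, eval_finsetSum]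
    refine Finset.sum_congr rfl fun i _ => ?_
    simp
  · intro m hm
    refine (List.length_filter_le _ _).trans ?_
    rw [hd, List.length_flatMap]
    exact List.single_le_sum (by simp) _ (List.mem_map_of_mem hm)

@[simp]
theorem length_deriv (p : UPoly) : (deriv p).length = p.length - 1 := by simp [deriv]

@[simp]
theorem length_remStep (p q : UPoly) : (remStep q p).length = p.length - 1 := by simp [remStep]

theorem length_iterate_remStep (p q : UPoly) (n : ℕ) :
    ((remStep q)^[n] p).length = p.length - n := by
  induction n with
  | zero => rfl
  | succ n ih => rw [Function.iterate_succ_apply', length_remStep, ih]; omega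

theorem length_rem (p q : UPoly) (h : q.length ≤ p.length) : (rem p q).length = q.length - 1 := by
  rw [rem, length_iterate_remStep]; omega

theorem toReal_deriv (v : ℕ → ℝ) (p : UPoly) : toReal v (deriv p) = (toReal v p).derivative := by
  rw [deriv, toReal_map_range, toReal_eq_sum, derivative_sum]
  rcases p.length with _ | n
  · simp
  · rw [Finset.sum_range_succ]
    simp only [Nat.add_sub_cancel, Nat.sub_self, pow_zero, mul_one, derivative_C, add_zero]
    refine Finset.sum_congr rfl fun i hi => ?_
    have := Finset.mem_range.1 hi
    rw [derivative_C_mul_X_pow, MPoly.eval_smul, Nat.sub_right_comm, mul_comm (MPoly.eval _ _)]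

theorem toReal_remStep (v : ℕ → ℝ) (p q : UPoly) (hq : q ≠ []) (h : q.length ≤ p.length) :
    toReal v (remStep q p) = C (q.headI.eval v ^ 2) * toReal v p -
      C (q.headI.eval v * p.headI.eval v) * X ^ (p.length - q.length) * toReal v q := by
  obtain ⟨b, q, rfl⟩ := List.exists_cons_of_ne_nil hq
  obtain ⟨a, p, rfl⟩ : ∃ a p', p = a :: p' :=
    List.exists_cons_of_ne_nil (by rintro rfl; simp at h)
  have hl : q.length ≤ p.length := by simpa using h
  have e₁ := toReal_mul_X_pow v q p.length hl
  have e₂ := toReal_eq_sum v p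
  rw [remStep, toReal_map_range]
  simp only [List.length_cons, Nat.add_sub_cancel, List.headI_cons, List.tail_cons,
    MPoly.eval_sub, MPoly.eval_mul, toReal, C_sub, C_mul, sub_mul, Finset.sum_sub_distrib,
    Nat.add_sub_add_right, C_pow]
  have hX : (X : ℝ[X]) ^ p.length = X ^ (p.length - q.length) * X ^ q.length := by
    rw [← pow_add, Nat.sub_add_cancel hl]
  have s₁ : ∑ i ∈ Finset.range p.length, C (b.eval v) * C (b.eval v) *
      C ((p.getD i []).eval v) * X ^ (p.length - 1 - i) =
      C (b.eval v) * C (b.eval v) * toReal v p := by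
    rw [e₂, Finset.mul_sum]
    exact Finset.sum_congr rfl fun i _ => by ring
  have s₂ : ∑ i ∈ Finset.range p.length, C (b.eval v) * C (a.eval v) *
      C ((q.getD i []).eval v) * X ^ (p.length - 1 - i) =
      C (b.eval v) * C (a.eval v) * (toReal v q * X ^ (p.length - q.length)) := by
    rw [e₁, Finset.mul_sum]
    exact Finset.sum_congr rfl fun i _ => by ring
  rw [s₁, s₂, hX]
  ring

theorem sign_eval_rem (v : ℕ → ℝ) (p q : UPoly) (hq : q ≠ []) (h : q.length ≤ p.length)
    (hb : q.headI.eval v ≠ 0) (x : ℝ) (hx : (toReal v q).eval x = 0) :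
    SignType.sign ((toReal v (rem p q)).eval x) = SignType.sign ((toReal v p).eval x) := by
  suffices H : ∀ n, q.length + n ≤ p.length + 1 →
      SignType.sign ((toReal v ((remStep q)^[n] p)).eval x) =
        SignType.sign ((toReal v p).eval x) from H _ (by omega)
  intro n
  induction n with
  | zero => intro; rfl
  | succ n ih =>
    intro hn
    rw [Function.iterate_succ_apply', toReal_remStep v _ _ hq
      (by rw [length_iterate_remStep]; omega), ← ih (by omega)]
    simp only [eval_sub, eval_mul, eval_C, hx, mul_zero, sub_zero]
    rw [sign_mul, sign_pos (by positivity), one_mul]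

theorem coeff_toReal_of_le (v : ℕ → ℝ) (p : UPoly) {n : ℕ} (h : p.length ≤ n) :
    (toReal v p).coeff n = 0 := by
  induction p with
  | nil => simp [toReal]
  | cons a p ih =>
    have : p.length + 1 ≤ n := by simpa using h
    rw [toReal, coeff_add, coeff_C_mul_X_pow, if_neg (by omega), ih (by omega), zero_add]

theorem coeff_toReal_cons (v : ℕ → ℝ) (a : MPoly) (p : UPoly) :
    (toReal v (a :: p)).coeff p.length = a.eval v := by
  rw [toReal, coeff_add, coeff_C_mul_X_pow, if_pos rfl, coeff_toReal_of_le v p le_rfl, add_zero]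

theorem degree_toReal_pos (v : ℕ → ℝ) (p : UPoly) (h : 2 ≤ p.length) (hp : p.headI.eval v ≠ 0) :
    0 < (toReal v p).degree := by
  rcases p with _ | ⟨a, p⟩
  · simp at h
  · have := coeff_toReal_cons v a p
    have h' : 0 < p.length := by simp at h; omega
    refine lt_of_lt_of_le ?_ (le_degree_of_ne_zero (n := p.length) (by rw [this]; exact hp))
    exact_mod_cast h'

section Primrec

variable {α : Type} [Primcodable α] {f g : α → UPoly}

@[fun_prop]
theorem ofMPoly_primrec {f : α → MPoly} (hf : Primrec f) : Primrec fun a => ofMPoly (f a) := by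
  unfold ofMPoly; fun_prop

@[fun_prop]
theorem deriv_primrec (hf : Primrec f) : Primrec fun a => deriv (f a) := by
  unfold deriv; fun_prop

@[fun_prop]
theorem remStep_primrec (hf : Primrec f) (hg : Primrec g) :
    Primrec fun a => remStep (f a) (g a) := by
  unfold remStep; fun_prop

@[fun_prop]
theorem rem_primrec (hf : Primrec f) (hg : Primrec g) : Primrec fun a => rem (f a) (g a) := by
  unfold rem; fun_prop

end Primrec

/-! ### Closure under derivatives, remainders and deletion of leading terms -/

def closureStep (S : List UPoly) : List UPoly :=
  S ++ S.flatMap fun q => q.tail :: deriv q ::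
    (S.filter fun p => decide (q.length ≤ p.length)).map fun p => rem p q

def closure (S : List UPoly) : List UPoly := closureStep^[S.flatten.length + 1] S

structure IsClosed (S : List UPoly) : Prop where
  tail_mem : ∀ q ∈ S, q.tail ∈ S
  deriv_mem : ∀ q ∈ S, deriv q ∈ S
  rem_mem : ∀ q ∈ S, ∀ p ∈ S, q.length ≤ p.length → rem p q ∈ S

theorem mem_closureStep {S : List UPoly} {r : UPoly} : r ∈ closureStep S ↔
    r ∈ S ∨ ∃ q ∈ S, r = q.tail ∨ r = deriv q ∨ ∃ p ∈ S, q.length ≤ p.length ∧ r = rem p q := by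
  simp [closureStep, and_assoc, eq_comm]

theorem closureStep_subset_of_length {L : List UPoly} (k : ℕ) (r : UPoly)
    (hr : r ∈ closureStep (closureStep^[k] L)) (hk : L.flatten.length + 1 ≤ r.length + k) :
    r ∈ closureStep^[k] L := by
  induction k generalizing r with
  | zero =>
    have hL : ∀ q ∈ L, q.length ≤ L.flatten.length := fun q hq => by
      rw [List.length_flatten]
      exact List.single_le_sum (by simp) _ (List.mem_map_of_mem hq)
    rcases mem_closureStep.1 hr with h | ⟨q, hq, h⟩
    · exact h
    · have : r.length = q.length - 1 := by
        rcases h with rfl | rfl | ⟨p, -, h, rfl⟩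
        · simp
        · simp
        · exact length_rem _ _ h
      have := hL q hq
      omega
  | succ k ih =>
    have hsub : closureStep^[k] L ⊆ closureStep^[k + 1] L := by
      rw [Function.iterate_succ_apply']
      exact List.subset_append_left _ _
    have key : ∀ q ∈ closureStep^[k + 1] L, r.length + 1 ≤ q.length → q ∈ closureStep^[k] L :=
      fun q hq h => ih q (by rwa [← Function.iterate_succ_apply' closureStep]) (by omega)
    rcases mem_closureStep.1 hr with h | ⟨q, hq, h⟩
    · exact h
    · have hl : r.length = q.length - 1 := by
        rcases h with rfl | rfl | ⟨p, -, h, rfl⟩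
        · simp
        · simp
        · exact length_rem _ _ h
      by_cases hq0 : q.length = 0
      · have hr0 : r = q := by
          rw [List.length_eq_zero_iff.1 hq0, ← List.length_eq_zero_iff]
          omega
        rwa [hr0]
      · rw [Function.iterate_succ_apply']
        refine mem_closureStep.2 (Or.inr ⟨q, key q hq (by omega), ?_⟩)
        rcases h with h | h | ⟨p, hp, h, h'⟩
        · exact Or.inl h
        · exact Or.inr (Or.inl h)
        · exact Or.inr (Or.inr ⟨p, key p hp (by omega), h, h'⟩)

theorem isClosed_closure (L : List UPoly) : IsClosed (closure L) := by
  have key : ∀ r ∈ closureStep (closure L), r ∈ closure L := fun r hr =>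
    closureStep_subset_of_length _ r hr (by omega)
  exact ⟨fun q hq => key _ (mem_closureStep.2 (Or.inr ⟨q, hq, Or.inl rfl⟩)),
    fun q hq => key _ (mem_closureStep.2 (Or.inr ⟨q, hq, Or.inr (Or.inl rfl)⟩)),
    fun q hq p hp h => key _ (mem_closureStep.2
      (Or.inr ⟨q, hq, Or.inr (Or.inr ⟨p, hp, h, rfl⟩)⟩))⟩

theorem subset_closure (L : List UPoly) : L ⊆ closure L := by
  rw [closure]
  generalize L.flatten.length + 1 = n
  induction n with
  | zero => exact List.Subset.refl _
  | succ n ih =>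
    rw [Function.iterate_succ_apply']
    exact List.Subset.trans ih (List.subset_append_left _ _)

@[fun_prop]
theorem closure_primrec {α : Type} [Primcodable α] {f : α → List UPoly} (hf : Primrec f) :
    Primrec fun a => closure (f a) := by
  unfold closure closureStep; fun_prop

/-- The elements of a list of polynomials, ordered by length. -/
def sortByLength (S : List UPoly) : List UPoly :=
  (List.range (S.flatten.length + 1)).flatMap fun e => S.filter fun p => decide (p.length = e)

theorem mem_sortByLength {S : List UPoly} {p : UPoly} : p ∈ sortByLength S ↔ p ∈ S := by
  simp only [sortByLength, List.mem_flatMap, List.mem_range, List.mem_filter, decide_eq_true_eq]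
  refine ⟨fun ⟨_, _, h, _⟩ => h, fun h => ⟨p.length, ?_, h, rfl⟩⟩
  rw [Nat.lt_succ_iff, List.length_flatten]
  exact List.single_le_sum (by simp) _ (List.mem_map_of_mem h)

theorem pairwise_sortByLength (S : List UPoly) :
    (sortByLength S).Pairwise fun p q => p.length ≤ q.length := by
  rw [sortByLength, List.pairwise_flatMap]
  refine ⟨fun e _ => ?_, List.pairwise_lt_range.imp fun {e e'} h p hp q hq => ?_⟩
  · refine List.pairwise_of_forall_mem_list fun p hp q hq => ?_
    simp only [List.mem_filter, decide_eq_true_eq] at hp hq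
    omega
  · simp only [List.mem_filter, decide_eq_true_eq] at hp hq
    omega

@[fun_prop]
theorem sortByLength_primrec {α : Type} [Primcodable α] {f : α → List UPoly} (hf : Primrec f) :
    Primrec fun a => sortByLength (f a) := by
  unfold sortByLength; fun_prop

end UPoly

/-! ### Signs of monotone functions on intervals -/

section Monotone

open SignType

theorem signs_of_strictMonoOn {f : ℝ → ℝ} {I : Set ℝ} (hI : I.OrdConnected) (hne : I.Nonempty)
    (hf : Continuous f) (hmono : StrictMonoOn f I) {sL sR : SignType}
    (hL : (sL ≠ 0 ∧ ∃ x₀ ∈ I, ∀ x ∈ I, x ≤ x₀ → sign (f x) = sL) ∨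
      (sL = 0 ∧ ∀ x ∈ I, sign (f x) = 1))
    (hR : (sR ≠ 0 ∧ ∃ x₀ ∈ I, ∀ x ∈ I, x₀ ≤ x → sign (f x) = sR) ∨
      (sR = 0 ∧ ∀ x ∈ I, sign (f x) = -1)) :
    if sL ≠ 0 ∧ sR = -sL then
      ∃ r ∈ I, f r = 0 ∧ (∀ x ∈ I, x < r → sign (f x) = sL) ∧ ∀ x ∈ I, r < x → sign (f x) = sR
    else ∀ x ∈ I, sign (f x) = if sL = 0 then sR else sL := by
  obtain ⟨y, hy⟩ := hne
  rcases hL with ⟨hsL, x₀, hx₀, hL⟩ | ⟨rfl, hL⟩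
  · rcases hR with ⟨hsR, x₁, hx₁, hR⟩ | ⟨rfl, hR⟩
    · by_cases h : sR = -sL
      · rw [if_pos ⟨hsL, h⟩]
        have e₀ := hL x₀ hx₀ le_rfl
        have e₁ := hR x₁ hx₁ le_rfl
        have hs : sL = -1 := by
          have hmin : min x₀ x₁ ∈ I := by
            rcases min_choice x₀ x₁ with h | h <;> rw [h] <;> assumption
          have hmax : max x₀ x₁ ∈ I := by
            rcases max_choice x₀ x₁ with h | h <;> rw [h] <;> assumption
          by_contra hne
          have hs1 : sL = 1 := by revert hsL hne; cases sL <;> decide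
          subst hs1
          have a₁ := sign_eq_one_iff.1 (hL _ hmin (min_le_left _ _))
          have a₂ := sign_eq_neg_one_iff.1 ((hR _ hmax (le_max_right _ _)).trans h)
          have := hmono.monotoneOn hmin hmax (min_le_max (a := x₀) (b := x₁))
          linarith
        subst hs
        have hs' : sR = 1 := by rw [h]; rfl
        subst hs'
        have h₀ : f x₀ < 0 := sign_eq_neg_one_iff.1 e₀
        have h₁ : 0 < f x₁ := sign_eq_one_iff.1 e₁
        have hlt : x₀ ≤ x₁ := by
          by_contra hlt
          have := hmono.monotoneOn hx₁ hx₀ (not_le.1 hlt).le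
          linarith
        obtain ⟨r, hr, hr0⟩ := intermediate_value_Icc hlt hf.continuousOn ⟨h₀.le, h₁.le⟩
        have hrI := hI.out hx₀ hx₁ hr
        refine ⟨r, hrI, hr0, fun x hx hxr => ?_, fun x hx hxr => ?_⟩
        · exact sign_neg (hr0 ▸ hmono hx hrI hxr)
        · exact sign_pos (hr0 ▸ hmono hrI hx hxr)
      · rw [if_neg fun h' => h h'.2]
        have hs : sR = sL := by revert hsL hsR h; cases sL <;> cases sR <;> decide
        subst hs
        intro x hx
        rw [if_neg hsL]
        rcases le_total x x₀ with h₀ | h₀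
        · exact hL x hx h₀
        rcases le_total x₁ x with h₁ | h₁
        · exact hR x hx h₁
        have e₀ := hL x₀ hx₀ le_rfl
        have e₁ := hR x₁ hx₁ le_rfl
        have m₀ := hmono.monotoneOn hx₀ hx h₀
        have m₁ := hmono.monotoneOn hx hx₁ h₁
        have hs : sR = 1 ∨ sR = -1 := by revert hsL; cases sR <;> decide
        rcases hs with rfl | rfl
        · exact sign_pos ((sign_eq_one_iff.1 e₀).trans_le m₀)
        · exact sign_neg (m₁.trans_lt (sign_eq_neg_one_iff.1 e₁))
    · rw [if_neg (by rintro ⟨_, h⟩; revert hsL h; cases sL <;> decide)]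
      intro x hx
      rw [if_neg hsL, hR x hx, ← hL x₀ hx₀ le_rfl, hR x₀ hx₀]
  · rw [if_neg (by simp)]
    intro x hx
    rcases hR with ⟨hsR, x₁, hx₁, hR⟩ | ⟨rfl, hR⟩
    · rw [if_pos rfl, hL x hx, ← hR x₁ hx₁ le_rfl, hL x₁ hx₁]
    · have h₁ := hL x hx
      rw [hR x hx] at h₁
      exact absurd h₁ (by decide)

theorem signs_of_strictAntiOn {f : ℝ → ℝ} {I : Set ℝ} (hI : I.OrdConnected) (hne : I.Nonempty)
    (hf : Continuous f) (hmono : StrictAntiOn f I) {sL sR : SignType}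
    (hL : (sL ≠ 0 ∧ ∃ x₀ ∈ I, ∀ x ∈ I, x ≤ x₀ → sign (f x) = sL) ∨
      (sL = 0 ∧ ∀ x ∈ I, sign (f x) = -1))
    (hR : (sR ≠ 0 ∧ ∃ x₀ ∈ I, ∀ x ∈ I, x₀ ≤ x → sign (f x) = sR) ∨
      (sR = 0 ∧ ∀ x ∈ I, sign (f x) = 1)) :
    if sL ≠ 0 ∧ sR = -sL then
      ∃ r ∈ I, f r = 0 ∧ (∀ x ∈ I, x < r → sign (f x) = sL) ∧ ∀ x ∈ I, r < x → sign (f x) = sR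
    else ∀ x ∈ I, sign (f x) = if sL = 0 then sR else sL := by
  have H : ∀ (x : ℝ) (s : SignType), sign (-f x) = -s ↔ sign (f x) = s := fun x s => by
    rw [Left.sign_neg, neg_inj]
  have := signs_of_strictMonoOn (f := fun x => -f x) (sL := -sL) (sR := -sR) hI hne hf.neg
    (fun x hx y hy h => neg_lt_neg (hmono hx hy h))
    (by
      rcases hL with ⟨h, x₀, hx₀, hL⟩ | ⟨h, hL⟩
      · exact Or.inl ⟨by simpa using h, x₀, hx₀, fun x hx hxx => (H _ _).2 (hL x hx hxx)⟩
      · exact Or.inr ⟨by simpa using h, fun x hx => (H x (-1)).2 (hL x hx)⟩)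
    (by
      rcases hR with ⟨h, x₀, hx₀, hR⟩ | ⟨h, hR⟩
      · exact Or.inl ⟨by simpa using h, x₀, hx₀, fun x hx hxx => (H _ _).2 (hR x hx hxx)⟩
      · exact Or.inr ⟨by simpa using h, fun x hx => (H x 1).2 (hR x hx)⟩)
  by_cases h : sL ≠ 0 ∧ sR = -sL
  · rw [if_pos ⟨by simpa using h.1, by rw [h.2]⟩] at this
    rw [if_pos h]
    simpa only [H, neg_eq_zero] using this
  · rw [if_neg fun h' => h ⟨by simpa using h'.1, neg_inj.1 h'.2⟩] at this
    rw [if_neg h]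
    intro x hx
    have := this x hx
    rw [Left.sign_neg, neg_eq_iff_eq_neg] at this
    rw [this]
    cases sL <;> simp

open Polynomial Filter

/-- The interval between `a` and `b`. -/
def openInterval (a : WithBot ℝ) (b : WithTop ℝ) : Set ℝ :=
  {x | a < (x : WithBot ℝ) ∧ (x : WithTop ℝ) < b}

/-- `s` is the sign of `f` at `a`, or near `-∞` if `a = ⊥`, where it must not be zero. -/
def LeftSign (f : ℝ[X]) (s : SignType) : WithBot ℝ → Prop
  | ⊥ => s ≠ 0 ∧ ∀ᶠ x in atBot, sign (f.eval x) = s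
  | (a : ℝ) => s = sign (f.eval a)

/-- `s` is the sign of `f` at `b`, or near `∞` if `b = ⊤`, where it must not be zero. -/
def RightSign (f : ℝ[X]) (s : SignType) : WithTop ℝ → Prop
  | ⊤ => s ≠ 0 ∧ ∀ᶠ x in atTop, sign (f.eval x) = s
  | (b : ℝ) => s = sign (f.eval b)

theorem ordConnected_openInterval (a : WithBot ℝ) (b : WithTop ℝ) :
    (openInterval a b).OrdConnected :=
  ⟨fun _ hx _ hy _ hz => ⟨hx.1.trans_le (WithBot.coe_le_coe.2 hz.1),
    (WithTop.coe_le_coe.2 hz.2).trans_lt hy.2⟩⟩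

theorem eventually_sign_eq (f : ℝ[X]) {a : ℝ} (ha : f.eval a ≠ 0) :
    ∀ᶠ x in nhds a, sign (f.eval x) = sign (f.eval a) :=
  (ContinuousAt.comp (f := fun x => f.eval x) (continuousAt_sign_of_ne_zero ha)
    f.continuous.continuousAt).eventually_mem
    (s := {sign (f.eval a)}) (by simp)

theorem sign_eval_sub (f : ℝ[X]) {a b : ℝ} (hab : a < b) {d : SignType}
    (hd : ∀ x, a < x → x < b → sign (f.derivative.eval x) = d) :
    sign (f.eval b - f.eval a) = d := by
  obtain ⟨c, hc, h⟩ := exists_hasDerivAt_eq_slope (fun x => f.eval x) (fun x => f.derivative.eval x)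
    hab f.continuousOn fun x _ => f.hasDerivAt x
  rw [eq_div_iff (sub_pos.2 hab).ne'] at h
  rw [← h, sign_mul, sign_pos (sub_pos.2 hab), mul_one, hd c hc.1 hc.2]

variable {f : ℝ[X]} {a : WithBot ℝ} {b : WithTop ℝ} {d s : SignType}

theorem LeftSign.exists_mem (h : LeftSign f s a) (hne : (openInterval a b).Nonempty)
    (hd : ∀ x ∈ openInterval a b, sign (f.derivative.eval x) = d) :
    (s ≠ 0 ∧ ∃ x₀ ∈ openInterval a b, ∀ x ∈ openInterval a b, x ≤ x₀ → sign (f.eval x) = s) ∨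
      (s = 0 ∧ ∀ x ∈ openInterval a b, sign (f.eval x) = d) := by
  obtain ⟨y, hy⟩ := hne
  induction a using WithBot.recBotCoe with
  | bot =>
    obtain ⟨hs, h⟩ := h
    obtain ⟨N, hN⟩ := eventually_atBot.1 h
    exact Or.inl ⟨hs, min y N, ⟨WithBot.bot_lt_coe _,
      (WithTop.coe_le_coe.2 (min_le_left _ _)).trans_lt hy.2⟩,
      fun x _ hx => hN x (hx.trans (min_le_right _ _))⟩
  | coe a =>
    have h : s = sign (f.eval a) := h
    subst h
    have hay : a < y := WithBot.coe_lt_coe.1 hy.1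
    by_cases h0 : f.eval a = 0
    · refine Or.inr ⟨by rw [h0, sign_zero], fun x hx => ?_⟩
      rw [← sub_zero (f.eval x), ← h0]
      exact sign_eval_sub f (WithBot.coe_lt_coe.1 hx.1) fun c hc hcx =>
        hd c ⟨WithBot.coe_lt_coe.2 hc, (WithTop.coe_lt_coe.2 hcx).trans hx.2⟩
    · obtain ⟨ε, hε, H⟩ := Metric.eventually_nhds_iff.1 (eventually_sign_eq f h0)
      refine Or.inl ⟨sign_ne_zero.2 h0, min y (a + ε / 2), ⟨WithBot.coe_lt_coe.2
        (lt_min hay (by linarith)), (WithTop.coe_le_coe.2 (min_le_left _ _)).trans_lt hy.2⟩,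
        fun x hx hx' => H ?_⟩
      have h₁ : a < x := WithBot.coe_lt_coe.1 hx.1
      have h₂ := hx'.trans (min_le_right _ _)
      rw [Real.dist_eq, abs_lt]
      constructor <;> linarith

theorem RightSign.exists_mem (h : RightSign f s b) (hne : (openInterval a b).Nonempty)
    (hd : ∀ x ∈ openInterval a b, sign (f.derivative.eval x) = d) :
    (s ≠ 0 ∧ ∃ x₀ ∈ openInterval a b, ∀ x ∈ openInterval a b, x₀ ≤ x → sign (f.eval x) = s) ∨
      (s = 0 ∧ ∀ x ∈ openInterval a b, sign (f.eval x) = -d) := by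
  obtain ⟨y, hy⟩ := hne
  induction b using WithTop.recTopCoe with
  | top =>
    obtain ⟨hs, h⟩ := h
    obtain ⟨N, hN⟩ := eventually_atTop.1 h
    exact Or.inl ⟨hs, max y N, ⟨hy.1.trans_le (WithBot.coe_le_coe.2 (le_max_left _ _)),
      WithTop.coe_lt_top _⟩, fun x _ hx => hN x ((le_max_right _ _).trans hx)⟩
  | coe b =>
    have h : s = sign (f.eval b) := h
    subst h
    have hay : y < b := WithTop.coe_lt_coe.1 hy.2
    by_cases h0 : f.eval b = 0
    · refine Or.inr ⟨by rw [h0, sign_zero], fun x hx => ?_⟩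
      have := sign_eval_sub f (WithTop.coe_lt_coe.1 hx.2) fun c hc hcx =>
        hd c ⟨hx.1.trans (WithBot.coe_lt_coe.2 hc), WithTop.coe_lt_coe.2 hcx⟩
      rw [h0, zero_sub, Left.sign_neg] at this
      rw [← this, neg_neg]
    · obtain ⟨ε, hε, H⟩ := Metric.eventually_nhds_iff.1 (eventually_sign_eq f h0)
      refine Or.inl ⟨sign_ne_zero.2 h0, max y (b - ε / 2),
        ⟨hy.1.trans_le (WithBot.coe_le_coe.2 (le_max_left _ _)), WithTop.coe_lt_coe.2
        (max_lt hay (by linarith))⟩, fun x hx hx' => H ?_⟩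
      have h₁ : x < b := WithTop.coe_lt_coe.1 hx.2
      have h₂ := (le_max_right _ _).trans hx'
      rw [Real.dist_eq, abs_lt]
      constructor <;> linarith

theorem signs_of_deriv (hne : (openInterval a b).Nonempty) (hd0 : d ≠ 0)
    (hd : ∀ x ∈ openInterval a b, sign (f.derivative.eval x) = d) {sL sR : SignType}
    (hL : LeftSign f sL a) (hR : RightSign f sR b) :
    if sL ≠ 0 ∧ sR = -sL then
      ∃ r ∈ openInterval a b, f.eval r = 0 ∧
        (∀ x ∈ openInterval a b, x < r → sign (f.eval x) = sL) ∧
        ∀ x ∈ openInterval a b, r < x → sign (f.eval x) = sR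
    else ∀ x ∈ openInterval a b, sign (f.eval x) = if sL = 0 then sR else sL := by
  have hI := ordConnected_openInterval a b
  have hL' := hL.exists_mem hne hd
  have hR' := hR.exists_mem hne hd
  have hd' : d = 1 ∨ d = -1 := by revert hd0; cases d <;> decide
  have hs : ∀ x ∈ openInterval a b, ∀ y ∈ openInterval a b, x < y →
      sign (f.eval y - f.eval x) = d := fun x hx y hy hxy =>
    sign_eval_sub f hxy fun c hc hcx => hd c (hI.out hx hy ⟨hc.le, hcx.le⟩)
  rcases hd' with rfl | rfl
  · exact signs_of_strictMonoOn hI hne f.continuous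
      (fun x hx y hy h => sub_pos.1 (sign_eq_one_iff.1 (hs x hx y hy h))) hL' hR'
  · exact signs_of_strictAntiOn hI hne f.continuous
      (fun x hx y hy h => sub_neg.1 (sign_eq_neg_one_iff.1 (hs x hx y hy h))) hL' hR'

theorem leftSign_bot (hf : 0 < f.degree) (hne : (openInterval ⊥ b).Nonempty) (hd0 : d ≠ 0)
    (hd : ∀ x ∈ openInterval ⊥ b, sign (f.derivative.eval x) = d) : LeftSign f (-d) ⊥ := by
  refine ⟨by simpa using hd0, ?_⟩
  obtain ⟨y, hy⟩ := hne
  have ht := f.tendsto_norm_atTop hf (z := fun x => x) tendsto_abs_atBot_atTop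
  filter_upwards [ht.eventually_gt_atTop ‖f.eval y‖, eventually_lt_atBot y] with x hx hxy
  have hs := sign_eval_sub f hxy fun c _ hc => hd c ⟨WithBot.bot_lt_coe _,
    (WithTop.coe_lt_coe.2 hc).trans hy.2⟩
  rw [Real.norm_eq_abs, Real.norm_eq_abs] at hx
  have hd' : d = 1 ∨ d = -1 := by revert hd0; cases d <;> decide
  rcases hd' with rfl | rfl
  · have := sub_pos.1 (sign_eq_one_iff.1 hs)
    refine sign_neg ?_
    by_contra h
    rw [abs_of_nonneg (not_lt.1 h), abs_of_pos ((not_lt.1 h).trans_lt this)] at hx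
    linarith
  · have := sub_neg.1 (sign_eq_neg_one_iff.1 hs)
    rw [neg_neg]
    refine sign_pos ?_
    by_contra h
    rw [abs_of_nonpos (not_lt.1 h), abs_of_neg (this.trans_le (not_lt.1 h))] at hx
    linarith

theorem rightSign_top (hf : 0 < f.degree) (hne : (openInterval a ⊤).Nonempty) (hd0 : d ≠ 0)
    (hd : ∀ x ∈ openInterval a ⊤, sign (f.derivative.eval x) = d) : RightSign f d ⊤ := by
  refine ⟨hd0, ?_⟩
  obtain ⟨y, hy⟩ := hne
  have ht := f.tendsto_norm_atTop hf (tendsto_norm_atTop_atTop)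
  filter_upwards [ht.eventually_gt_atTop ‖f.eval y‖, eventually_gt_atTop y] with x hx hxy
  have hs := sign_eval_sub f hxy fun c hc _ => hd c ⟨hy.1.trans (WithBot.coe_lt_coe.2 hc),
    WithTop.coe_lt_top _⟩
  rw [Real.norm_eq_abs, Real.norm_eq_abs] at hx
  have hd' : d = 1 ∨ d = -1 := by revert hd0; cases d <;> decide
  rcases hd' with rfl | rfl
  · have := sub_pos.1 (sign_eq_one_iff.1 hs)
    refine sign_pos ?_
    by_contra h
    rw [abs_of_nonpos (not_lt.1 h), abs_of_neg (this.trans_le (not_lt.1 h))] at hx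
    linarith
  · have := sub_neg.1 (sign_eq_neg_one_iff.1 hs)
    refine sign_neg ?_
    by_contra h
    rw [abs_of_nonneg (not_lt.1 h), abs_of_pos ((not_lt.1 h).trans_lt this)] at hx
    linarith

end Monotone

/-! ### Sign tables -/

open SignType

/-- The signs of some polynomials at a point. -/
abbrev Column := List (UPoly × SignType)

/-- A sign table: the columns of the first interval, and of each dividing point together with the
interval on its right. -/
abbrev SignTable := Column × List (Column × Column)

namespace SignTable

/-- The value at `a` of the function given by the list of arguments and the list of values. -/
def coeffSign (σ : List MPoly × List SignType) (a : MPoly) : SignType :=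
  σ.2.getD (σ.1.idxOf a) 0

def signIn (c : Column) (p : UPoly) : SignType := (c.lookup p).getD 0

def columns (t : SignTable) : List Column := t.1 :: t.2.flatMap fun e => [e.1, e.2]

/-- The sign of `p` at a dividing point, read off from the remainder of `p` modulo a polynomial
that vanishes there. -/
def signAtRoot (σ : List MPoly × List SignType) (p : UPoly) (c : Column) : SignType :=
  signIn c (UPoly.rem p ((c.filter fun e =>
    decide (e.2 = 0 ∧ ¬ coeffSign σ e.1.headI = 0 ∧ 2 ≤ e.1.length)).map Prod.fst).headI)

/-- The column `c` of an interval extended by the sign of `p`, a polynomial that is monotone on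
the interval and has the signs `sL` and `sR` at its end points. -/
def splitInterval (p : UPoly) (c : Column) (sL sR : SignType) : SignTable :=
  if ¬ sL = 0 ∧ sR = -sL then ((p, sL) :: c, [((p, 0) :: c, (p, sR) :: c)])
  else ((p, if sL = 0 then sR else sL) :: c, [])

def insertRight (σ : List MPoly × List SignType) (p : UPoly) (d : SignType)
    (l : List (Column × Column)) : SignType × List (Column × Column) :=
  l.foldr (fun e out => (signAtRoot σ p e.1,
    ((p, signAtRoot σ p e.1) :: e.1, (splitInterval p e.2 (signAtRoot σ p e.1) out.1).1) ::
      ((splitInterval p e.2 (signAtRoot σ p e.1) out.1).2 ++ out.2))) (d, [])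

/-- Insertion of a nonconstant polynomial. -/
def insertRow (σ : List MPoly × List SignType) (t : SignTable) (p : UPoly) : SignTable :=
  let out := insertRight σ p (signIn ((t.2.map Prod.snd).getLastD t.1) p.deriv) t.2
  let s := splitInterval p t.1 (-signIn t.1 p.deriv) out.1
  (s.1, s.2 ++ out.2)

/-- The sign of a polynomial that is constant or has the leading coefficient `0`. -/
def signOfDegenerate (σ : List MPoly × List SignType) (p : UPoly) (c : Column) : SignType :=
  if p.length = 0 then 0
  else if coeffSign σ p.headI = 0 then signIn c p.tail else coeffSign σ p.headI

def addRow (σ : List MPoly × List SignType) (t : SignTable) (p : UPoly) : SignTable :=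
  if p.length ≤ 1 ∨ coeffSign σ p.headI = 0 then
    ((p, signOfDegenerate σ p t.1) :: t.1, t.2.map fun e =>
      ((p, signOfDegenerate σ p e.1) :: e.1, (p, signOfDegenerate σ p e.2) :: e.2))
  else insertRow σ t p

def build (σ : List MPoly × List SignType) (S : List UPoly) : SignTable :=
  (UPoly.sortByLength S).foldl (addRow σ) ([], [])

section Primrec

variable {α : Type} [Primcodable α] {σ : α → List MPoly × List SignType} {c : α → Column}
  {p : α → UPoly} {t : α → SignTable} {s s' : α → SignType}

@[fun_prop]
theorem coeffSign_primrec {a : α → MPoly} (hσ : Primrec σ) (ha : Primrec a) :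
    Primrec fun x => coeffSign (σ x) (a x) := by
  unfold coeffSign; fun_prop

@[fun_prop]
theorem signIn_primrec (hc : Primrec c) (hp : Primrec p) : Primrec fun x => signIn (c x) (p x) := by
  unfold signIn; fun_prop

@[fun_prop]
theorem columns_primrec (ht : Primrec t) : Primrec fun x => columns (t x) := by
  unfold columns; fun_prop

@[fun_prop]
theorem signAtRoot_primrec (hσ : Primrec σ) (hp : Primrec p) (hc : Primrec c) :
    Primrec fun x => signAtRoot (σ x) (p x) (c x) := by
  unfold signAtRoot; fun_prop

@[fun_prop]
theorem splitInterval_primrec (hp : Primrec p) (hc : Primrec c) (hs : Primrec s)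
    (hs' : Primrec s') : Primrec fun x => splitInterval (p x) (c x) (s x) (s' x) := by
  unfold splitInterval; fun_prop

@[fun_prop]
theorem insertRight_primrec {l : α → List (Column × Column)} (hσ : Primrec σ) (hp : Primrec p)
    (hs : Primrec s) (hl : Primrec l) :
    Primrec fun x => insertRight (σ x) (p x) (s x) (l x) := by
  unfold insertRight; fun_prop

@[fun_prop]
theorem insertRow_primrec (hσ : Primrec σ) (ht : Primrec t) (hp : Primrec p) :
    Primrec fun x => insertRow (σ x) (t x) (p x) := by
  unfold insertRow; fun_prop

@[fun_prop]
theorem signOfDegenerate_primrec (hσ : Primrec σ) (hp : Primrec p) (hc : Primrec c) :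
    Primrec fun x => signOfDegenerate (σ x) (p x) (c x) := by
  unfold signOfDegenerate; fun_prop

@[fun_prop]
theorem addRow_primrec (hσ : Primrec σ) (ht : Primrec t) (hp : Primrec p) :
    Primrec fun x => addRow (σ x) (t x) (p x) := by
  unfold addRow; fun_prop

@[fun_prop]
theorem build_primrec {S : α → List UPoly} (hσ : Primrec σ) (hS : Primrec S) :
    Primrec fun x => build (σ x) (S x) := by
  unfold build; fun_prop

end Primrec

/-- The column of the polynomials `R` at the point `x`. -/
noncomputable def columnAt (v : ℕ → ℝ) (R : List UPoly) (x : ℝ) : Column :=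
  R.map fun p => (p, sign ((p.toReal v).eval x))

theorem signIn_columnAt {v : ℕ → ℝ} {R : List UPoly} {p : UPoly} (hp : p ∈ R) (x : ℝ) :
    signIn (columnAt v R x) p = sign ((p.toReal v).eval x) := by
  induction R with
  | nil => simp at hp
  | cons q R ih =>
    by_cases h : p = q
    · subst h; simp [signIn, columnAt]
    · have := ih (by simpa [h] using hp)
      have hb : (p == q) = false := by simpa using h
      simpa [signIn, columnAt, List.lookup_cons, hb] using this

theorem coeffSign_map (l : List MPoly) (f : MPoly → SignType) {a : MPoly} (ha : a ∈ l) :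
    coeffSign (l, l.map f) a = f a := by
  have := List.idxOf_lt_length_iff.2 ha
  simp [coeffSign, this]

/-- The columns `c` and `l` describe the signs of the polynomials `R` to the right of `a`. -/
def IsTable (v : ℕ → ℝ) (R : List UPoly) : WithBot ℝ → Column → List (Column × Column) → Prop
  | a, c, [] => ∀ x ∈ openInterval a ⊤, columnAt v R x = c
  | a, c, e :: l => ∃ r : ℝ, a < r ∧ (∀ x ∈ openInterval a r, columnAt v R x = c) ∧
      columnAt v R r = e.1 ∧
      (∃ q ∈ R, 2 ≤ q.length ∧ q.headI.eval v ≠ 0 ∧ (q.toReal v).eval r = 0) ∧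
      IsTable v R r e.2 l

theorem openInterval_nonempty {a : WithBot ℝ} {b : WithTop ℝ}
    (h : ∀ a' : ℝ, a = a' → (a' : WithTop ℝ) < b) :
    (openInterval a b).Nonempty := by
  induction a using WithBot.recBotCoe with
  | bot =>
    induction b using WithTop.recTopCoe with
    | top => exact ⟨0, WithBot.bot_lt_coe _, WithTop.coe_lt_top _⟩
    | coe b => exact ⟨b - 1, WithBot.bot_lt_coe _, WithTop.coe_lt_coe.2 (by linarith)⟩
  | coe a =>
    have h := h a rfl
    induction b using WithTop.recTopCoe with
    | top => exact ⟨a + 1, WithBot.coe_lt_coe.2 (by linarith), WithTop.coe_lt_top _⟩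
    | coe b =>
      obtain ⟨x, h₁, h₂⟩ := exists_between (WithTop.coe_lt_coe.1 h)
      exact ⟨x, WithBot.coe_lt_coe.2 h₁, WithTop.coe_lt_coe.2 h₂⟩

theorem IsTable.mem_columns {v : ℕ → ℝ} {R : List UPoly} {a : WithBot ℝ} {t : SignTable}
    (h : IsTable v R a t.1 t.2) (c : Column) :
    c ∈ columns t ↔ ∃ x : ℝ, a < x ∧ columnAt v R x = c := by
  obtain ⟨c₀, l⟩ := t
  induction l generalizing a c₀ with
  | nil =>
    have h : ∀ x ∈ openInterval a ⊤, columnAt v R x = c₀ := h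
    obtain ⟨y, hy⟩ := openInterval_nonempty (a := a) (b := ⊤) fun _ _ => WithTop.coe_lt_top _
    simp only [columns, List.flatMap_nil, List.mem_singleton]
    constructor
    · rintro rfl
      exact ⟨y, hy.1, h y hy⟩
    · rintro ⟨x, hx, rfl⟩
      exact h x ⟨hx, WithTop.coe_lt_top _⟩
  | cons e l ih =>
    obtain ⟨r, har, h₁, h₂, -, h₃⟩ := h
    obtain ⟨y, hy⟩ := openInterval_nonempty (a := a) (b := r) fun a' h => by
      subst h; exact WithTop.coe_lt_coe.2 (WithBot.coe_lt_coe.1 har)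
    have hmem : c ∈ columns (c₀, e :: l) ↔ c = c₀ ∨ c = e.1 ∨ c ∈ columns (e.2, l) := by
      simp [columns]
    rw [hmem, ih e.2 h₃]
    constructor
    · rintro (rfl | rfl | ⟨x, hx, h⟩)
      · exact ⟨y, hy.1, h₁ y hy⟩
      · exact ⟨r, har, h₂⟩
      · exact ⟨x, har.trans hx, h⟩
    · rintro ⟨x, hx, rfl⟩
      rcases lt_trichotomy x r with h | rfl | h
      · exact Or.inl (h₁ x ⟨hx, WithTop.coe_lt_coe.2 h⟩)
      · exact Or.inr (Or.inl h₂)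
      · exact Or.inr (Or.inr ⟨x, WithBot.coe_lt_coe.2 h, rfl⟩)

end SignTable

open SignType

namespace SignTable

open Polynomial in
theorem sign_derivative_ne_zero {f : ℝ[X]} (hf : 0 < f.degree) {a : WithBot ℝ} {b : WithTop ℝ}
    (hne : (openInterval a b).Nonempty) {d : SignType}
    (hd : ∀ x ∈ openInterval a b, sign (f.derivative.eval x) = d) : d ≠ 0 := by
  rintro rfl
  obtain ⟨y, hy⟩ := hne
  obtain ⟨z, hz⟩ := openInterval_nonempty (a := y) (b := b) fun a' h => by
    rw [← WithBot.coe_injective h]; exact hy.2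
  have hyz : y < z := WithBot.coe_lt_coe.1 hz.1
  have hzI : z ∈ openInterval a b := ⟨hy.1.trans hz.1, hz.2⟩
  have h0 : f.derivative = 0 := eq_zero_of_infinite_isRoot _ <| (Set.Ioo_infinite hyz).mono
    fun x hx => sign_eq_zero_iff.1
      (hd x ((ordConnected_openInterval a b).out hy hzI ⟨hx.1.le, hx.2.le⟩))
  have := derivative_eq_zero.1 h0
  exact absurd (natDegree_pos_iff_degree_pos.2 hf) (by omega)

variable {v : ℕ → ℝ} {R : List UPoly} {p : UPoly} {σ : List MPoly × List SignType}

theorem columnAt_cons (x : ℝ) :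
    columnAt v (p :: R) x = (p, sign ((p.toReal v).eval x)) :: columnAt v R x := rfl

/-- The columns `l` describe the signs of `R` at and to the right of `b`. -/
def IsContinuation (v : ℕ → ℝ) (R : List UPoly) :
    WithTop ℝ → List (Column × Column) → Prop
  | ⊤, l => l = []
  | (r : ℝ), l => ∃ e l', l = e :: l' ∧ columnAt v R r = e.1 ∧
      (∃ q ∈ R, 2 ≤ q.length ∧ q.headI.eval v ≠ 0 ∧ (q.toReal v).eval r = 0) ∧
      IsTable v R r e.2 l'

theorem IsContinuation.isTable {a : WithBot ℝ} {b : WithTop ℝ} {c : Column}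
    {l : List (Column × Column)} (h : IsContinuation v R b l) (hne : (openInterval a b).Nonempty)
    (hc : ∀ x ∈ openInterval a b, columnAt v R x = c) : IsTable v R a c l := by
  induction b using WithTop.recTopCoe with
  | top =>
    have h : l = [] := h
    subst h
    exact hc
  | coe r =>
    obtain ⟨e, l', rfl, h₁, h₂, h₃⟩ := h
    obtain ⟨y, hy⟩ := hne
    exact ⟨r, hy.1.trans (WithBot.coe_lt_coe.2 (WithTop.coe_lt_coe.1 hy.2)), hc, h₁, h₂, h₃⟩

theorem isTable_splitInterval {a : WithBot ℝ} {b : WithTop ℝ} {c : Column}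
    {l : List (Column × Column)} {sL sR : SignType} (hp : 2 ≤ p.length) (hp' : p.headI.eval v ≠ 0)
    (hne : (openInterval a b).Nonempty) (hc : ∀ x ∈ openInterval a b, columnAt v R x = c)
    (hs : if sL ≠ 0 ∧ sR = -sL then
      ∃ r ∈ openInterval a b, (p.toReal v).eval r = 0 ∧
        (∀ x ∈ openInterval a b, x < r → sign ((p.toReal v).eval x) = sL) ∧
        ∀ x ∈ openInterval a b, r < x → sign ((p.toReal v).eval x) = sR
      else ∀ x ∈ openInterval a b, sign ((p.toReal v).eval x) = if sL = 0 then sR else sL)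
    (hl : IsContinuation v (p :: R) b l) :
    IsTable v (p :: R) a (splitInterval p c sL sR).1 ((splitInterval p c sL sR).2 ++ l) := by
  rw [splitInterval]
  split_ifs at hs ⊢ with h h0
  · obtain ⟨r, hr, h0, h₁, h₂⟩ := hs
    refine ⟨r, hr.1, fun x hx => ?_, ?_, ⟨p, List.mem_cons_self, hp, hp', h0⟩, ?_⟩
    · have hx' : x ∈ openInterval a b := ⟨hx.1, hx.2.trans hr.2⟩
      rw [columnAt_cons, hc x hx', h₁ x hx' (WithTop.coe_lt_coe.1 hx.2)]
    · rw [columnAt_cons, hc r hr, h0, sign_zero]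
    · refine hl.isTable (openInterval_nonempty fun a' h => ?_) fun x hx => ?_
      · rw [← WithBot.coe_injective h]
        exact hr.2
      · have hx' : x ∈ openInterval a b := ⟨hr.1.trans hx.1, hx.2⟩
        rw [columnAt_cons, hc x hx', h₂ x hx' (WithBot.coe_lt_coe.1 hx.1)]
  · refine hl.isTable hne fun x hx => ?_
    rw [columnAt_cons, hc x hx, hs x hx]
  · refine hl.isTable hne fun x hx => ?_
    rw [columnAt_cons, hc x hx, hs x hx]

theorem signAtRoot_eq (hσ : ∀ q ∈ R, coeffSign σ q.headI = sign (q.headI.eval v))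
    (hR : ∀ q ∈ R, q.length ≤ p.length ∧ (2 ≤ q.length → UPoly.rem p q ∈ R)) {r : ℝ}
    (hr : ∃ q ∈ R, 2 ≤ q.length ∧ q.headI.eval v ≠ 0 ∧ (q.toReal v).eval r = 0) :
    signAtRoot σ p (columnAt v R r) = sign ((p.toReal v).eval r) := by
  rw [signAtRoot]
  set l := ((columnAt v R r).filter fun e =>
    decide (e.2 = 0 ∧ ¬ coeffSign σ e.1.headI = 0 ∧ 2 ≤ e.1.length)).map Prod.fst with hl
  have hmem : ∀ q, q ∈ l ↔
      q ∈ R ∧ (q.toReal v).eval r = 0 ∧ q.headI.eval v ≠ 0 ∧ 2 ≤ q.length := by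
    intro q
    simp only [hl, columnAt, List.mem_map, List.mem_filter, decide_eq_true_eq]
    constructor
    · rintro ⟨_, ⟨⟨q, hq, rfl⟩, h₀, h₁, h₂⟩, rfl⟩
      simp only [hσ q hq] at h₁
      exact ⟨hq, sign_eq_zero_iff.1 h₀, sign_ne_zero.1 h₁, h₂⟩
    · rintro ⟨hq, h₀, h₁, h₂⟩
      refine ⟨_, ⟨⟨q, hq, rfl⟩, sign_eq_zero_iff.2 h₀, ?_, h₂⟩, rfl⟩
      simp only [hσ q hq]
      exact sign_ne_zero.2 h₁
  obtain ⟨q, hq, h₂, h₁, h₀⟩ := hr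
  obtain ⟨q', l', hl'⟩ := List.exists_cons_of_ne_nil
    (List.ne_nil_of_mem ((hmem q).2 ⟨hq, h₀, h₁, h₂⟩))
  obtain ⟨hq, h₀, h₁, h₂⟩ := (hmem q').1 (hl' ▸ List.mem_cons_self)
  rw [hl', List.headI_cons, signIn_columnAt ((hR q' hq).2 h₂)]
  exact UPoly.sign_eval_rem v p q' (by rintro rfl; simp at h₂) (hR q' hq).1 h₁ r h₀

theorem isTable_insertRight (hσ : ∀ q ∈ R, coeffSign σ q.headI = sign (q.headI.eval v))
    (hR : ∀ q ∈ R, q.length ≤ p.length ∧ (2 ≤ q.length → UPoly.rem p q ∈ R))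
    (hd : p.deriv ∈ R) (hp : 2 ≤ p.length) (hp' : p.headI.eval v ≠ 0)
    {a : WithBot ℝ} {c : Column} {l : List (Column × Column)} (h : IsTable v R a c l)
    {sL : SignType} (hsL : LeftSign (p.toReal v) sL a) :
    let out := insertRight σ p (signIn ((l.map Prod.snd).getLastD c) p.deriv) l
    IsTable v (p :: R) a (splitInterval p c sL out.1).1
      ((splitInterval p c sL out.1).2 ++ out.2) := by
  have hdeg := UPoly.degree_toReal_pos v p hp hp'
  have hderiv : ∀ {a : WithBot ℝ} {b : WithTop ℝ} {c : Column},
      (∀ x ∈ openInterval a b, columnAt v R x = c) →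
      ∀ x ∈ openInterval a b, sign ((p.toReal v).derivative.eval x) = signIn c p.deriv := by
    intro a b c hc x hx
    rw [← hc x hx, signIn_columnAt hd, UPoly.toReal_deriv]
  induction l generalizing a c sL with
  | nil =>
    have h : ∀ x ∈ openInterval a ⊤, columnAt v R x = c := h
    have hne : (openInterval a ⊤).Nonempty :=
      openInterval_nonempty fun _ _ => WithTop.coe_lt_top _
    have hd0 := sign_derivative_ne_zero hdeg hne (hderiv h)
    exact isTable_splitInterval hp hp' hne h
      (signs_of_deriv hne hd0 (hderiv h) hsL (rightSign_top hdeg hne hd0 (hderiv h)))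
      (b := ⊤) rfl
  | cons e l ih =>
    obtain ⟨r, har, hc, hr, hq, ht⟩ := h
    have hne : (openInterval a r).Nonempty := openInterval_nonempty fun a' h => by
      subst h; exact WithTop.coe_lt_coe.2 (WithBot.coe_lt_coe.1 har)
    have hd0 := sign_derivative_ne_zero hdeg hne (hderiv hc)
    have hs : signAtRoot σ p e.1 = sign ((p.toReal v).eval r) := by
      rw [← hr]; exact signAtRoot_eq hσ hR hq
    have hlast : ((e :: l).map Prod.snd).getLastD c = (l.map Prod.snd).getLastD e.2 := by
      rw [List.map_cons, List.getLastD_cons]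
    intro out
    have hout : out = insertRight σ p (signIn ((l.map Prod.snd).getLastD e.2) p.deriv) (e :: l) := by
      rw [← hlast]
    rw [hout]
    refine isTable_splitInterval hp hp' hne hc
      (signs_of_deriv hne hd0 (hderiv hc) hsL (b := (r : WithTop ℝ)) hs) ?_
    refine ⟨_, _, rfl, ?_, ?_, ih ht (a := (r : WithBot ℝ)) hs⟩
    · rw [columnAt_cons, hr, hs]
    · obtain ⟨q, hq, h⟩ := hq
      exact ⟨q, List.mem_cons_of_mem _ hq, h⟩

theorem isTable_insertRow (hσ : ∀ q ∈ R, coeffSign σ q.headI = sign (q.headI.eval v))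
    (hR : ∀ q ∈ R, q.length ≤ p.length ∧ (2 ≤ q.length → UPoly.rem p q ∈ R))
    (hd : p.deriv ∈ R) (hp : 2 ≤ p.length) (hp' : p.headI.eval v ≠ 0)
    {t : SignTable} (h : IsTable v R ⊥ t.1 t.2) :
    IsTable v (p :: R) ⊥ (insertRow σ t p).1 (insertRow σ t p).2 := by
  refine isTable_insertRight hσ hR hd hp hp' h ?_
  have hdeg := UPoly.degree_toReal_pos v p hp hp'
  obtain ⟨b, hne, hc⟩ : ∃ b, (openInterval ⊥ b).Nonempty ∧
      ∀ x ∈ openInterval ⊥ b, columnAt v R x = t.1 := by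
    obtain ⟨c, l⟩ := t
    cases l with
    | nil => exact ⟨⊤, openInterval_nonempty fun _ _ => WithTop.coe_lt_top _, h⟩
    | cons e l =>
      obtain ⟨r, -, hc, -⟩ := h
      exact ⟨r, openInterval_nonempty fun a' h => absurd h WithBot.bot_ne_coe, hc⟩
  have hderiv : ∀ x ∈ openInterval ⊥ b, sign ((p.toReal v).derivative.eval x) =
      signIn t.1 p.deriv := by
    intro x hx
    rw [← hc x hx, signIn_columnAt hd, UPoly.toReal_deriv]
  exact leftSign_bot hdeg hne (sign_derivative_ne_zero hdeg hne hderiv) hderiv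

theorem isTable_map {f : Column → SignType}
    (hf : ∀ x, f (columnAt v R x) = sign ((p.toReal v).eval x)) {a : WithBot ℝ} {c : Column}
    {l : List (Column × Column)} (h : IsTable v R a c l) :
    IsTable v (p :: R) a ((p, f c) :: c)
      (l.map fun e => ((p, f e.1) :: e.1, (p, f e.2) :: e.2)) := by
  have key : ∀ {x : ℝ} {c : Column}, columnAt v R x = c →
      columnAt v (p :: R) x = (p, f c) :: c := by
    rintro x c rfl
    rw [columnAt_cons, hf]
  induction l generalizing a c with
  | nil => exact fun x hx => key (h x hx)
  | cons e l ih =>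
    obtain ⟨r, har, hc, hr, ⟨q, hq, hq'⟩, ht⟩ := h
    exact ⟨r, har, fun x hx => key (hc x hx), key hr, ⟨q, List.mem_cons_of_mem _ hq, hq'⟩, ih ht⟩

theorem isTable_addRow (hσ : ∀ q ∈ p :: R, coeffSign σ q.headI = sign (q.headI.eval v))
    (hR : ∀ q ∈ R, q.length ≤ p.length ∧ (2 ≤ q.length → UPoly.rem p q ∈ R))
    (hd : 2 ≤ p.length → p.deriv ∈ R) (htail : p ≠ [] → p.tail ∈ R)
    {t : SignTable} (h : IsTable v R ⊥ t.1 t.2) :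
    IsTable v (p :: R) ⊥ (addRow σ t p).1 (addRow σ t p).2 := by
  have hσp := hσ p List.mem_cons_self
  rw [addRow]
  split_ifs with hp
  · refine isTable_map (f := signOfDegenerate σ p) (fun x => ?_) h
    rcases p with _ | ⟨a, p⟩
    · simp [signOfDegenerate, UPoly.toReal]
    · have h0 : (a :: p).length ≠ 0 := by simp
      rw [signOfDegenerate, if_neg h0, hσp, List.headI_cons]
      split_ifs with ha
      · rw [signIn_columnAt (htail (by simp)), List.tail_cons, UPoly.toReal,
          sign_eq_zero_iff.1 ha]
        simp
      · have hlen : (a :: p).length ≤ 1 := hp.resolve_right (by rwa [hσp])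
        have : p = [] := by simpa using hlen
        subst this
        simp [UPoly.toReal]
  · rw [not_or] at hp
    have h2 : 2 ≤ p.length := by omega
    exact isTable_insertRow (fun q hq => hσ q (List.mem_cons_of_mem _ hq)) hR (hd h2) h2
      (by rw [hσp] at hp; exact sign_ne_zero.1 hp.2) h

theorem isTable_build {S : List UPoly} (hS : UPoly.IsClosed S)
    (hσ : ∀ q ∈ S, coeffSign σ q.headI = sign (q.headI.eval v)) :
    IsTable v (UPoly.sortByLength S).reverse ⊥ (build σ S).1 (build σ S).2 := by
  have hsort := UPoly.pairwise_sortByLength S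
  have hmem : ∀ p, p ∈ UPoly.sortByLength S ↔ p ∈ S := fun p => UPoly.mem_sortByLength
  rw [build]
  generalize UPoly.sortByLength S = O at hsort hmem
  suffices H : ∀ pre post, pre ++ post = O →
      IsTable v pre.reverse ⊥ (pre.foldl (addRow σ) ([], [])).1
        (pre.foldl (addRow σ) ([], [])).2 from H O [] (by simp)
  intro pre
  induction pre using List.reverseRecOn with
  | nil => exact fun _ _ x _ => rfl
  | append_singleton pre p ih =>
    intro post hpost
    have hO : pre ++ p :: post = O := by rw [← hpost]; simp
    rw [List.foldl_append, List.reverse_append]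
    have hpS : p ∈ S := (hmem p).1 (by rw [← hO]; simp)
    have hpre : ∀ q ∈ pre, q ∈ S := fun q hq => (hmem q).1 (by rw [← hO]; simp [hq])
    rw [← hO, List.pairwise_append, List.pairwise_cons] at hsort
    have hlt : ∀ q ∈ S, q.length < p.length → q ∈ pre.reverse := by
      intro q hq hlt
      have := (hmem q).2 hq
      rw [← hO, List.mem_append, List.mem_cons] at this
      rcases this with h | rfl | h
      · simpa using h
      · exact absurd hlt (lt_irrefl _)
      · exact absurd (hsort.2.1.1 q h) (by omega)
    refine isTable_addRow (R := pre.reverse) (fun q hq => ?_) (fun q hq => ?_) (fun h => ?_)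
      (fun h => ?_) (ih (p :: post) hO)
    · rcases List.mem_cons.1 hq with rfl | hq
      · exact hσ _ hpS
      · exact hσ _ (hpre q (by simpa using hq))
    · have hq' : q ∈ pre := by simpa using hq
      have hle := hsort.2.2 q hq' p List.mem_cons_self
      refine ⟨hle, fun h2 => hlt _ (hS.rem_mem q (hpre q hq') p hpS hle) ?_⟩
      rw [UPoly.length_rem _ _ hle]
      omega
    · refine hlt _ (hS.deriv_mem p hpS) ?_
      rw [UPoly.length_deriv]
      omega
    · refine hlt _ (hS.tail_mem p hpS) ?_
      have := List.length_pos_iff.2 h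
      rw [List.length_tail]
      omega

end SignTable

open SignType

/-! ### Quantifier elimination -/

/-- Quantifier-free formulas: a list of polynomials and the list of the admissible signs. -/
abbrev QFree := List MPoly × List (List SignType)

namespace QFree

def Holds (F : QFree) (v : ℕ → ℝ) : Prop := (F.1.map fun p => sign (p.eval v)) ∈ F.2

/-- All the lists of `n` signs. -/
def signLists (n : ℕ) : List (List SignType) :=
  (fun l => l.flatMap fun w => [0 :: w, 1 :: w, -1 :: w])^[n] [[]]

theorem mem_signLists (w : List SignType) : w ∈ signLists w.length := by
  induction w with
  | nil => simp [signLists]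
  | cons s w ih =>
    rw [List.length_cons, signLists, Function.iterate_succ_apply', List.mem_flatMap]
    exact ⟨w, ih, by cases s <;> simp⟩

def atom (p : MPoly) (s : List SignType) : QFree := ([p], s.map fun a => [a])

def imp (F G : QFree) : QFree :=
  (F.1 ++ G.1, (signLists (F.1.length + G.1.length)).filter fun w =>
    decide (¬ w.take F.1.length ∈ F.2 ∨ w.drop F.1.length ∈ G.2))

/-- Elimination of a universal quantifier over the variable `0`. -/
def all (F : QFree) : QFree :=
  ((UPoly.closure (F.1.map UPoly.ofMPoly)).map List.headI,
    (signLists (UPoly.closure (F.1.map UPoly.ofMPoly)).length).filter fun w =>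
      decide (∀ c ∈ SignTable.columns (SignTable.build
          ((UPoly.closure (F.1.map UPoly.ofMPoly)).map List.headI, w)
          (UPoly.closure (F.1.map UPoly.ofMPoly))),
        (F.1.map fun p => SignTable.signIn c (UPoly.ofMPoly p)) ∈ F.2))

theorem holds_atom (p : MPoly) (s : List SignType) (v : ℕ → ℝ) :
    (atom p s).Holds v ↔ sign (p.eval v) ∈ s := by
  simp [atom, Holds]

theorem holds_imp (F G : QFree) (v : ℕ → ℝ) :
    (imp F G).Holds v ↔ (F.Holds v → G.Holds v) := by
  have hmem := mem_signLists ((F.1 ++ G.1).map fun p => sign (p.eval v))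
  rw [List.length_map, List.length_append] at hmem
  rw [Holds, imp, List.mem_filter]
  rw [and_iff_right hmem, decide_eq_true_eq, List.map_append, List.take_left' (by simp),
    List.drop_left' (by simp), ← imp_iff_not_or]
  rfl

theorem holds_all (F : QFree) (v : ℕ → ℝ) :
    (all F).Holds v ↔ ∀ x, F.Holds (MPoly.push x v) := by
  set S := UPoly.closure (F.1.map UPoly.ofMPoly) with hS
  set w := (S.map List.headI).map fun p => sign (p.eval v) with hw
  have hmem := mem_signLists w
  rw [hw, List.length_map, List.length_map, ← hw] at hmem
  have ht := SignTable.isTable_build (v := v) (S := S) (UPoly.isClosed_closure _)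
    (σ := (S.map List.headI, w)) fun q hq => SignTable.coeffSign_map _ _ (List.mem_map_of_mem hq)
  have hcol : ∀ x, (F.1.map fun p => SignTable.signIn
      (SignTable.columnAt v (UPoly.sortByLength S).reverse x) (UPoly.ofMPoly p)) =
      F.1.map fun p => sign (p.eval (MPoly.push x v)) := by
    intro x
    refine List.map_congr_left fun p hp => ?_
    rw [SignTable.signIn_columnAt, UPoly.eval_ofMPoly]
    rw [List.mem_reverse, UPoly.mem_sortByLength]
    exact UPoly.subset_closure _ (List.mem_map_of_mem hp)
  rw [Holds, all, List.mem_filter]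
  simp only [← hS, ← hw, hmem, true_and, decide_eq_true_eq]
  constructor
  · intro h x
    have := h _ ((ht.mem_columns _).2 ⟨x, WithBot.bot_lt_coe _, rfl⟩)
    rwa [hcol] at this
  · intro h c hc
    obtain ⟨x, -, rfl⟩ := (ht.mem_columns c).1 hc
    rw [hcol]
    exact h x

section Primrec

variable {α : Type} [Primcodable α] {F G : α → QFree}

@[fun_prop]
theorem signLists_primrec {n : α → ℕ} (hn : Primrec n) : Primrec fun a => signLists (n a) := by
  unfold signLists; fun_prop

@[fun_prop]
theorem atom_primrec {p : α → MPoly} {s : α → List SignType} (hp : Primrec p) (hs : Primrec s) :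
    Primrec fun a => atom (p a) (s a) := by
  unfold atom; fun_prop

@[fun_prop]
theorem imp_primrec (hF : Primrec F) (hG : Primrec G) : Primrec fun a => imp (F a) (G a) := by
  unfold imp; fun_prop

@[fun_prop]
theorem all_primrec (hF : Primrec F) : Primrec fun a => all (F a) := by
  unfold all; fun_prop

end Primrec

/-- The assignment with the first `M` values taken from `f` and the others from `v`. -/
def stack (M : ℕ) (f v : ℕ → ℝ) (n : ℕ) : ℝ := if n < M then f n else v (n - M)

theorem holds_iterate_all (F : QFree) (M : ℕ) (v : ℕ → ℝ) :
    (all^[M] F).Holds v ↔ ∀ f, F.Holds (stack M f v) := by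
  induction M generalizing v with
  | zero => exact (forall_const (ℕ → ℝ)).symm
  | succ M ih =>
    have key : ∀ (f : ℕ → ℝ) (x : ℝ), stack M f (MPoly.push x v) =
        stack (M + 1) (fun n => if n = M then x else f n) v := by
      intro f x
      funext n
      rcases lt_trichotomy n M with h | rfl | h
      · simp [stack, h, h.ne, Nat.lt_succ_of_lt h]
      · simp [stack, MPoly.push]
      · obtain ⟨k, rfl⟩ := Nat.exists_eq_add_of_lt h
        have h₁ : M + k + 1 - M = k + 1 := by omega
        have h₂ : M + k + 1 - (M + 1) = k := by omega
        have h₃ : ¬ M + k + 1 < M := by omega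
        simp [stack, h₁, h₂, h₃, MPoly.push]
    rw [Function.iterate_succ_apply', holds_all]
    simp only [ih, key]
    constructor
    · intro h f
      have := h (f M) f
      rwa [show (fun n => if n = M then f M else f n) = f by
        funext n; split_ifs with h <;> simp [h]] at this
    · exact fun h x f => h _

/-- The truth value of a formula at the point all of whose coordinates are `1`. -/
def holdsAtOne (F : QFree) : Bool := decide ((F.1.map fun p => p.signAtOne) ∈ F.2)

theorem holdsAtOne_iff (F : QFree) : F.holdsAtOne = true ↔ F.Holds fun _ => 1 := by
  simp only [holdsAtOne, Holds, MPoly.sign_eval_one, decide_eq_true_eq]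

@[fun_prop]
theorem holdsAtOne_primrec {α : Type} [Primcodable α] {F : α → QFree} (hF : Primrec F) :
    Primrec fun a => holdsAtOne (F a) := by
  unfold holdsAtOne; fun_prop

end QFree

/-! ### Gödel numbers -/

theorem snd_unpair_lt {c : ℕ} (h : 1 ≤ c.unpair.1) : c.unpair.2 < c := by
  have h₁ := Nat.add_le_pair c.unpair.1 c.unpair.2
  rw [Nat.pair_unpair] at h₁
  omega

/-- The polynomial of a term, given by its Gödel number, at quantifier depth `n`. The variable
bound last has the index `0`. -/
def termPoly (n c : ℕ) : MPoly :=
  if h : 3 ≤ c.unpair.1 then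
    have : c.unpair.2.unpair.1 < c :=
      (Nat.unpair_left_le _).trans_lt (snd_unpair_lt (by omega))
    have : c.unpair.2.unpair.2 < c :=
      (Nat.unpair_right_le _).trans_lt (snd_unpair_lt (by omega))
    let s := termPoly n c.unpair.2.unpair.1
    let t := termPoly n c.unpair.2.unpair.2
    if c.unpair.1 = 3 then s ++ t else if c.unpair.1 = 4 then MPoly.sub s t else MPoly.mul s t
  else if c.unpair.1 = 0 then
    if c.unpair.2 % 2 = 0 then MPoly.var (n + c.unpair.2 / 2)
    else MPoly.var (n - 1 - c.unpair.2 / 2)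
  else if c.unpair.1 = 1 then [] else MPoly.nat 1
termination_by c

/-- The quantifier-free formula equivalent to a formula given by its Gödel number, at quantifier
depth `b.1`. -/
def formulaQFree (b : ℕ × ℕ) : QFree :=
  if h : b.2.unpair.1 = 3 then
    have : b.2.unpair.2.unpair.1 < b.2 :=
      (Nat.unpair_left_le _).trans_lt (snd_unpair_lt (by omega))
    have : b.2.unpair.2.unpair.2 < b.2 :=
      (Nat.unpair_right_le _).trans_lt (snd_unpair_lt (by omega))
    QFree.imp (formulaQFree (b.1, b.2.unpair.2.unpair.1))
      (formulaQFree (b.1, b.2.unpair.2.unpair.2))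
  else if h : b.2.unpair.1 = 4 then
    have : b.2.unpair.2 < b.2 := snd_unpair_lt (by omega)
    QFree.all (formulaQFree (b.1 + 1, b.2.unpair.2))
  else if b.2.unpair.1 = 0 then ([], [])
  else QFree.atom (MPoly.sub (termPoly b.1 b.2.unpair.2.unpair.1)
    (termPoly b.1 b.2.unpair.2.unpair.2)) [if b.2.unpair.1 = 1 then 0 else -1]
termination_by b.2

theorem termPoly_primrec₂ : Primrec₂ termPoly := by
  refine Primrec.nat_omega_rec (α := ℕ) (β := ℕ) (σ := MPoly) termPoly (m := fun _ c => c)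
    (l := fun _ c => if 3 ≤ c.unpair.1 then [c.unpair.2.unpair.1, c.unpair.2.unpair.2] else [])
    (g := fun n x => some (if 3 ≤ x.1.unpair.1 then
      if x.1.unpair.1 = 3 then x.2.getD 0 [] ++ x.2.getD 1 []
      else if x.1.unpair.1 = 4 then MPoly.sub (x.2.getD 0 []) (x.2.getD 1 [])
      else MPoly.mul (x.2.getD 0 []) (x.2.getD 1 [])
    else if x.1.unpair.1 = 0 then
      if x.1.unpair.2 % 2 = 0 then MPoly.var (n + x.1.unpair.2 / 2)
      else MPoly.var (n - 1 - x.1.unpair.2 / 2)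
    else if x.1.unpair.1 = 1 then [] else MPoly.nat 1)) Primrec₂.right ?_ ?_ ?_ ?_
  · unfold Primrec₂; fun_prop
  · exact Primrec₂.option_some_iff.2 (by unfold Primrec₂; fun_prop)
  · intro n c c' hc'
    split_ifs at hc' with h
    · have := snd_unpair_lt (c := c) (by omega)
      rcases List.mem_pair.1 hc' with rfl | rfl
      · exact (Nat.unpair_left_le _).trans_lt this
      · exact (Nat.unpair_right_le _).trans_lt this
    · simp at hc'
  · intro n c
    rw [termPoly]
    by_cases h : 3 ≤ c.unpair.1
    · simp only [h, if_true, dif_pos]; rfl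
    · simp only [h, if_false, dif_neg, not_false_eq_true]

theorem primrec_formulaQFree : Primrec formulaQFree := by
  have ht : Primrec fun x : ℕ × ℕ => termPoly x.1 x.2 := termPoly_primrec₂
  refine Primrec.nat_omega_rec' (β := ℕ × ℕ) (σ := QFree) formulaQFree (m := fun b => b.2)
    (l := fun b => if b.2.unpair.1 = 3 then
        [(b.1, b.2.unpair.2.unpair.1), (b.1, b.2.unpair.2.unpair.2)]
      else if b.2.unpair.1 = 4 then [(b.1 + 1, b.2.unpair.2)] else [])
    (g := fun b x => some (if b.2.unpair.1 = 3 then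
        QFree.imp (x.getD 0 ([], [])) (x.getD 1 ([], []))
      else if b.2.unpair.1 = 4 then QFree.all (x.getD 0 ([], []))
      else if b.2.unpair.1 = 0 then ([], [])
      else QFree.atom (MPoly.sub (termPoly b.1 b.2.unpair.2.unpair.1)
        (termPoly b.1 b.2.unpair.2.unpair.2)) [if b.2.unpair.1 = 1 then 0 else -1]))
    Primrec.snd ?_ ?_ ?_ ?_
  · fun_prop
  · have h₁ : ∀ {α : Type} [Primcodable α] {f g : α → ℕ}, Primrec f → Primrec g →
        Primrec fun a => termPoly (f a) (g a) := fun hf hg => ht.comp (hf.pair hg)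
    have h₂ : Primrec fun b : (ℕ × ℕ) × List QFree =>
      QFree.atom (MPoly.sub (termPoly b.1.1 b.1.2.unpair.2.unpair.1)
        (termPoly b.1.1 b.1.2.unpair.2.unpair.2))
        [if b.1.2.unpair.1 = 1 then (0 : SignType) else -1] :=
      QFree.atom_primrec (MPoly.sub_primrec (h₁ (by fun_prop) (by fun_prop))
        (h₁ (by fun_prop) (by fun_prop))) (by fun_prop)
    exact Primrec₂.option_some_iff.2 (by unfold Primrec₂; fun_prop)
  · intro b b' hb'
    split_ifs at hb' with h h'
    · have := snd_unpair_lt (c := b.2) (by omega)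
      rcases List.mem_pair.1 hb' with rfl | rfl
      · exact (Nat.unpair_left_le _).trans_lt this
      · exact (Nat.unpair_right_le _).trans_lt this
    · rw [List.mem_singleton] at hb'
      subst hb'
      exact snd_unpair_lt (by omega)
    · simp at hb'
  · intro b
    rw [formulaQFree]
    by_cases h : b.2.unpair.1 = 3
    · simp only [h, if_true, dif_pos]; rfl
    · by_cases h' : b.2.unpair.1 = 4
      · simp only [h', if_true, dif_pos]; rfl
      · simp only [h, h', if_false, dif_neg, not_false_eq_true]

@[fun_prop]
theorem formulaQFree_primrec {α : Type} [Primcodable α] {f : α → ℕ × ℕ} (hf : Primrec f) :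
    Primrec fun a => formulaQFree (f a) := primrec_formulaQFree.comp hf

/-- The assignment `v` gives the free variables the values `u`, and the bound variables the
values `xs`. -/
structure Represents {q n : ℕ} (v : ℕ → ℝ) (u : Fin q → ℝ) (xs : Fin n → ℝ) : Prop where
  free (i : Fin q) : v (n + i) = u i
  bound (k : Fin n) : v (n - 1 - k) = xs k

theorem Represents.push {q n : ℕ} {v : ℕ → ℝ} {u : Fin q → ℝ} {xs : Fin n → ℝ}
    (h : Represents v u xs) (x : ℝ) : Represents (MPoly.push x v) u (Fin.snoc xs x) where
  free i := by rw [show n + 1 + i = (n + i) + 1 by omega, MPoly.push, h.free]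
  bound k := by
    refine Fin.lastCases ?_ (fun k => ?_) k
    · simp [MPoly.push]
    · rw [Fin.snoc_castSucc, ← h.bound, Fin.val_castSucc,
        show n + 1 - 1 - (k : ℕ) = (n - 1 - k) + 1 by omega, MPoly.push]

theorem eval_termPoly {q n : ℕ} {v : ℕ → ℝ} {u : Fin q → ℝ} {xs : Fin n → ℝ}
    (h : Represents v u xs) (t : RLang.Term (Fin q ⊕ Fin n)) :
    (termPoly n (termCode varCode t)).eval v = t.realize (Sum.elim u xs) := by
  induction t with
  | var x =>
    rw [termPoly]
    rcases x with i | k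
    · simp [termCode, varCode, h.free]
    · have h₂ : (2 * (k : ℕ) + 1) / 2 = k := by omega
      simp [termCode, varCode, h₂, h.bound]
  | func f ts ih =>
    rw [termPoly]
    cases f with
    | zero => simp [termCode, FirstOrder.Language.Structure.funMap]
    | one => simp [termCode, FirstOrder.Language.Structure.funMap]
    | add => simp [termCode, FirstOrder.Language.Structure.funMap, ih]
    | sub => simp [termCode, FirstOrder.Language.Structure.funMap, ih]
    | mul => simp [termCode, FirstOrder.Language.Structure.funMap, ih]

theorem holds_formulaQFree {q n : ℕ} (φ : RLang.BoundedFormula (Fin q) n) {v : ℕ → ℝ}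
    {u : Fin q → ℝ} {xs : Fin n → ℝ} (h : Represents v u xs) :
    (formulaQFree (n, formulaCode φ)).Holds v ↔ φ.Realize u xs := by
  induction φ generalizing v with
  | falsum =>
    rw [formulaQFree]
    simp [formulaCode, QFree.Holds, FirstOrder.Language.BoundedFormula.Realize]
  | equal s t =>
    rw [formulaQFree]
    simp [formulaCode, QFree.holds_atom, FirstOrder.Language.BoundedFormula.Realize,
      eval_termPoly h, sign_eq_zero_iff, sub_eq_zero]
  | rel R ts =>
    rw [formulaQFree]
    cases R
    simp [formulaCode, QFree.holds_atom, FirstOrder.Language.BoundedFormula.Realize,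
      eval_termPoly h, sign_eq_neg_one_iff, FirstOrder.Language.Structure.RelMap]
  | imp φ χ ihφ ihχ =>
    rw [formulaQFree]
    simp [formulaCode, QFree.holds_imp, FirstOrder.Language.BoundedFormula.Realize, ihφ h, ihχ h]
  | all φ ih =>
    rw [formulaQFree]
    simp [formulaCode, QFree.holds_all, FirstOrder.Language.BoundedFormula.Realize,
      ih (h.push _)]

/-! ### Translation of the verification problem -/

open SignType

namespace QFree

def isZero (p : MPoly) : QFree := atom p [0]

def isNonneg (p : MPoly) : QFree := atom p [0, 1]

theorem holds_isZero (p : MPoly) (v : ℕ → ℝ) : (isZero p).Holds v ↔ p.eval v = 0 := by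
  simp [isZero, holds_atom]

theorem holds_isNonneg (p : MPoly) (v : ℕ → ℝ) : (isNonneg p).Holds v ↔ 0 ≤ p.eval v := by
  rw [isNonneg, holds_atom, ← sign_nonneg_iff]
  cases sign (p.eval v) <;> decide

theorem holds_foldr_imp (H : List QFree) (F : QFree) (v : ℕ → ℝ) :
    (H.foldr imp F).Holds v ↔ ((∀ G ∈ H, G.Holds v) → F.Holds v) := by
  induction H with
  | nil => simp
  | cons G H ih => simp [holds_imp, ih]

/-- The inequality `r ≤ p`. -/
def ratLe (r : RatCode) (p : MPoly) : QFree :=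
  isNonneg (MPoly.sub (MPoly.smul r.2 p) (MPoly.int r.1))

/-- The inequality `p ≤ r`. -/
def leRat (p : MPoly) (r : RatCode) : QFree :=
  isNonneg (MPoly.sub (MPoly.int r.1) (MPoly.smul r.2 p))

theorem holds_ratLe (r : ℚ) (p : MPoly) (v : ℕ → ℝ) :
    (ratLe (ratCode r) p).Holds v ↔ (r : ℝ) ≤ p.eval v := by
  have hr : (0 : ℝ) < r.den := by exact_mod_cast r.den_pos
  rw [ratLe, holds_isNonneg, MPoly.eval_sub, MPoly.eval_smul, MPoly.eval_int, sub_nonneg, ratCode,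
    Rat.cast_def, div_le_iff₀ hr, mul_comm]

theorem holds_leRat (r : ℚ) (p : MPoly) (v : ℕ → ℝ) :
    (leRat p (ratCode r)).Holds v ↔ p.eval v ≤ (r : ℝ) := by
  have hr : (0 : ℝ) < r.den := by exact_mod_cast r.den_pos
  rw [leRat, holds_isNonneg, MPoly.eval_sub, MPoly.eval_smul, MPoly.eval_int, sub_nonneg, ratCode,
    Rat.cast_def, le_div_iff₀ hr, mul_comm]

/-- The conditions for the value of `p` to be the algebraic number `a`. -/
def isAlgebraic (p : MPoly) (a : AlgebraicCode) : List QFree :=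
  [ratLe a.2.1 p, leRat p a.2.2,
    isZero (a.1.foldr (fun z s => MPoly.int z ++ MPoly.mul p s) [])]

theorem eval_horner (p : MPoly) (v : ℕ → ℝ) (f : ℕ → ℤ) (n : ℕ) :
    (((List.range n).map f).foldr (fun z s => MPoly.int z ++ MPoly.mul p s) []).eval v =
      ∑ i ∈ Finset.range n, (f i : ℝ) * p.eval v ^ i := by
  induction n generalizing f with
  | zero => simp
  | succ n ih =>
    rw [List.range_succ_eq_map, List.map_cons, List.map_map, List.foldr_cons, MPoly.eval_append,
      MPoly.eval_mul, ih, Finset.sum_range_succ', Finset.mul_sum, MPoly.eval_int, add_comm]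
    congr 1
    · exact Finset.sum_congr rfl fun i _ => by simp only [Function.comp]; ring
    · simp

theorem holds_isAlgebraic {a : AlgebraicDescription} {x : ℝ} (h : a.Describes x) (p : MPoly)
    (v : ℕ → ℝ) : (∀ G ∈ isAlgebraic p a.code, G.Holds v) ↔ p.eval v = x := by
  rw [← h.2 (p.eval v)]
  simp only [isAlgebraic, AlgebraicDescription.code, List.forall_mem_cons, holds_ratLe,
    holds_leRat, holds_isZero, eval_horner, List.not_mem_nil, false_imp_iff, implies_true,
    and_true, and_assoc, Polynomial.aeval_eq_sum_range, zsmul_eq_mul]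

end QFree

/-- The product of the denominators in the weight matrix. -/
def codeDenom (L : List (List (ℤ × ℕ))) : ℕ :=
  (L.flatMap fun r => r.map Prod.snd).foldr (fun a b => a * b) 1

/-- The polynomials `B` (numerator) and `A` in `exp (W₁ y + b₁)_i = B / A`, where the variables
`o, o + 1, …, o + p - 1` stand for `exp (y_j / d)`. -/
def neuronNum (o p d : ℕ) (row : List (ℤ × ℕ)) (r : RatCode) : MPoly :=
  MPoly.mul (MPoly.int r.1) (MPoly.prod ((List.range p).map fun j =>
    MPoly.pow (MPoly.var (o + j)) (d * (row.getD j (0, 0)).1.toNat / (row.getD j (0, 0)).2)))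

def neuronDen (o p d : ℕ) (row : List (ℤ × ℕ)) (r : RatCode) : MPoly :=
  MPoly.mul (MPoly.nat r.2) (MPoly.prod ((List.range p).map fun j =>
    MPoly.pow (MPoly.var (o + j)) (d * (-(row.getD j (0, 0)).1).toNat / (row.getD j (0, 0)).2)))

section Conditions

/-! The variables are `u_k` with the index `k`, the entries of `b₂` with the indices `q + k`, the
values of the neurons with `2 q + i`, the exponentials of the inputs with `2 q + N + j` and
the entries of `W₂` with `2 q + N + p + k N + i`. -/

variable (p N q : ℕ)

def biasConditions (C : List AlgebraicCode) : List QFree :=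
  (List.range q).flatMap fun k =>
    QFree.isAlgebraic (MPoly.var (q + k)) (C.getD k ([], (0, 0), (0, 0)))

def weightConditions (W : List (List AlgebraicCode)) : List QFree :=
  (List.range q).flatMap fun k => (List.range N).flatMap fun i =>
    QFree.isAlgebraic (MPoly.var (2 * q + N + p + k * N + i))
      ((W.getD k []).getD i ([], (0, 0), (0, 0)))

def inputConditions (a b : List RatCode) : List QFree :=
  (List.range p).flatMap fun j =>
    [QFree.ratLe (a.getD j (0, 0)) (MPoly.var (2 * q + N + j)),
      QFree.leRat (MPoly.var (2 * q + N + j)) (b.getD j (0, 0))]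

def neuronConditions (L : List (List (ℤ × ℕ))) (e : List RatCode) : List QFree :=
  (List.range N).map fun i => QFree.isZero (MPoly.sub
    (MPoly.mul (MPoly.var (2 * q + i))
      (neuronDen (2 * q + N) p (codeDenom L) (L.getD i []) (e.getD i (0, 0)) ++
        neuronNum (2 * q + N) p (codeDenom L) (L.getD i []) (e.getD i (0, 0))))
    (neuronNum (2 * q + N) p (codeDenom L) (L.getD i []) (e.getD i (0, 0))))

def outputConditions : List QFree :=
  (List.range q).map fun k => QFree.isZero (MPoly.sub (MPoly.var k)
    (MPoly.sum ((List.range N).map fun i =>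
      MPoly.mul (MPoly.var (2 * q + N + p + k * N + i)) (MPoly.var (2 * q + i))) ++
      MPoly.var (q + k)))

end Conditions

def conditions (x : InstanceCode) : List QFree :=
  biasConditions x.1.2.2 x.2.2.2.2.2.2.1 ++
  (weightConditions x.1.1 x.1.2.1 x.1.2.2 x.2.2.2.2.2.1 ++
  (inputConditions x.1.1 x.1.2.1 x.1.2.2 x.2.2.2.1 x.2.2.2.2.1 ++
  (neuronConditions x.1.1 x.1.2.1 x.1.2.2 x.2.1 x.2.2.1 ++
  outputConditions x.1.1 x.1.2.1 x.1.2.2)))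

/-- The decision procedure. -/
def decideInstance (x : InstanceCode) : Bool :=
  QFree.holdsAtOne (QFree.all^[2 * x.1.2.2 + x.1.2.1 + x.1.1 + x.1.2.2 * x.1.2.1]
    ((conditions x).foldr QFree.imp (formulaQFree (0, x.2.2.2.2.2.2.2))))

section Primrec

variable {α : Type} [Primcodable α] {f : α → MPoly} {r : α → RatCode} {p N q d : α → ℕ}
  {L : α → List (List (ℤ × ℕ))} {row : α → List (ℤ × ℕ)} {e e' : α → List RatCode}
  {C : α → List AlgebraicCode} {W : α → List (List AlgebraicCode)}

@[fun_prop]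
theorem isZero_primrec (hf : Primrec f) : Primrec fun x => QFree.isZero (f x) := by
  unfold QFree.isZero; fun_prop

@[fun_prop]
theorem ratLe_primrec (hr : Primrec r) (hf : Primrec f) :
    Primrec fun x => QFree.ratLe (r x) (f x) := by
  unfold QFree.ratLe QFree.isNonneg; fun_prop

@[fun_prop]
theorem leRat_primrec (hf : Primrec f) (hr : Primrec r) :
    Primrec fun x => QFree.leRat (f x) (r x) := by
  unfold QFree.leRat QFree.isNonneg; fun_prop

@[fun_prop]
theorem isAlgebraic_primrec {a : α → AlgebraicCode} (hf : Primrec f) (ha : Primrec a) :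
    Primrec fun x => QFree.isAlgebraic (f x) (a x) := by
  unfold QFree.isAlgebraic; fun_prop

@[fun_prop]
theorem codeDenom_primrec (hL : Primrec L) : Primrec fun x => codeDenom (L x) := by
  unfold codeDenom; fun_prop

@[fun_prop]
theorem neuronNum_primrec {o : α → ℕ} (ho : Primrec o) (hp : Primrec p) (hd : Primrec d)
    (hrow : Primrec row) (hr : Primrec r) :
    Primrec fun x => neuronNum (o x) (p x) (d x) (row x) (r x) := by
  unfold neuronNum; fun_prop

@[fun_prop]
theorem neuronDen_primrec {o : α → ℕ} (ho : Primrec o) (hp : Primrec p) (hd : Primrec d)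
    (hrow : Primrec row) (hr : Primrec r) :
    Primrec fun x => neuronDen (o x) (p x) (d x) (row x) (r x) := by
  unfold neuronDen; fun_prop

@[fun_prop]
theorem biasConditions_primrec (hq : Primrec q) (hC : Primrec C) :
    Primrec fun x => biasConditions (q x) (C x) := by
  unfold biasConditions; fun_prop

@[fun_prop]
theorem weightConditions_primrec (hp : Primrec p) (hN : Primrec N) (hq : Primrec q)
    (hW : Primrec W) : Primrec fun x => weightConditions (p x) (N x) (q x) (W x) := by
  unfold weightConditions; fun_prop

@[fun_prop]
theorem inputConditions_primrec (hp : Primrec p) (hN : Primrec N) (hq : Primrec q)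
    (he : Primrec e) (he' : Primrec e') :
    Primrec fun x => inputConditions (p x) (N x) (q x) (e x) (e' x) := by
  unfold inputConditions; fun_prop

@[fun_prop]
theorem neuronConditions_primrec (hp : Primrec p) (hN : Primrec N) (hq : Primrec q)
    (hL : Primrec L) (he : Primrec e) :
    Primrec fun x => neuronConditions (p x) (N x) (q x) (L x) (e x) := by
  unfold neuronConditions; fun_prop

@[fun_prop]
theorem outputConditions_primrec (hp : Primrec p) (hN : Primrec N) (hq : Primrec q) :
    Primrec fun x => outputConditions (p x) (N x) (q x) := by
  unfold outputConditions; fun_prop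

theorem decideInstance_primrec : Primrec decideInstance := by
  unfold decideInstance conditions; fun_prop

end Primrec

/-! ### Correctness of the translation -/

theorem getD_ofFn {α : Type} {n : ℕ} (f : Fin n → α) (d : α) {i : ℕ} (hi : i < n) :
    (List.ofFn f).getD i d = f ⟨i, hi⟩ := by
  simp [hi]

theorem prod_map_range {n : ℕ} (f : ℕ → ℝ) : ((List.range n).map f).prod = ∏ i : Fin n, f i := by
  rw [← List.prod_ofFn, List.ofFn_eq_map, ← List.map_coe_finRange_eq_range, List.map_map]
  rfl

theorem sum_map_range {n : ℕ} (f : ℕ → ℝ) : ((List.range n).map f).sum = ∑ i : Fin n, f i := by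
  rw [← List.sum_ofFn, List.ofFn_eq_map, ← List.map_coe_finRange_eq_range, List.map_map]
  rfl

theorem codeDenom_ofFn {p N : ℕ} (P : Matrix (Fin N) (Fin p) ℤ) (Q : Matrix (Fin N) (Fin p) ℕ) :
    codeDenom (List.ofFn fun i => List.ofFn fun j => (P i j, Q i j)) = denomProd Q := by
  change List.prod _ = _
  rw [List.flatMap_def, List.prod_flatten, List.map_map, denomProd, List.map_ofFn, List.prod_ofFn]
  refine Finset.prod_congr rfl fun i _ => ?_
  simp only [Function.comp, List.map_ofFn, List.prod_ofFn]

section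

variable {p N q : ℕ} {v : ℕ → ℝ}

theorem holds_biasConditions {c₂ : Fin q → AlgebraicDescription} {b : Fin q → ℝ}
    (h : ∀ k, (c₂ k).Describes (b k)) :
    (∀ G ∈ biasConditions q (List.ofFn fun k => (c₂ k).code), G.Holds v) ↔
      ∀ k : Fin q, v (q + k) = b k := by
  simp only [biasConditions, List.mem_flatMap, List.mem_range, forall_exists_index, and_imp]
  constructor
  · intro H k
    have := (QFree.holds_isAlgebraic (h k) (MPoly.var (q + k)) v).1 fun G hG =>
      H G k k.2 (by rwa [getD_ofFn _ _ k.2])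
    simpa using this
  · intro H G k hk hG
    rw [getD_ofFn _ _ hk] at hG
    exact (QFree.holds_isAlgebraic (h ⟨k, hk⟩) _ v).2 (by simpa using H ⟨k, hk⟩) G hG

theorem holds_weightConditions {w₂ : Matrix (Fin q) (Fin N) AlgebraicDescription}
    {W : Matrix (Fin q) (Fin N) ℝ} (h : ∀ k i, (w₂ k i).Describes (W k i)) :
    (∀ G ∈ weightConditions p N q (List.ofFn fun k => List.ofFn fun i => (w₂ k i).code),
      G.Holds v) ↔
      ∀ (k : Fin q) (i : Fin N), v (2 * q + N + p + k * N + i) = W k i := by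
  simp only [weightConditions, List.mem_flatMap, List.mem_range, forall_exists_index, and_imp]
  constructor
  · intro H k i
    have := (QFree.holds_isAlgebraic (h k i) (MPoly.var (2 * q + N + p + k * N + i)) v).1
      fun G hG => H G k k.2 i i.2 (by rwa [getD_ofFn _ _ k.2, getD_ofFn _ _ i.2])
    simpa using this
  · intro H G k hk i hi hG
    rw [getD_ofFn _ _ hk, getD_ofFn _ _ hi] at hG
    exact (QFree.holds_isAlgebraic (h ⟨k, hk⟩ ⟨i, hi⟩) _ v).2
      (by simpa using H ⟨k, hk⟩ ⟨i, hi⟩) G hG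

theorem holds_inputConditions (a b : Fin p → ℚ) :
    (∀ G ∈ inputConditions p N q (List.ofFn fun j => ratCode (a j))
      (List.ofFn fun j => ratCode (b j)), G.Holds v) ↔
      ∀ j : Fin p, (a j : ℝ) ≤ v (2 * q + N + j) ∧ v (2 * q + N + j) ≤ b j := by
  simp only [inputConditions, List.mem_flatMap, List.mem_range, forall_exists_index, and_imp]
  constructor
  · intro H j
    constructor
    · have := H (QFree.ratLe (ratCode (a j)) (MPoly.var (2 * q + N + j))) j j.2
        (by rw [getD_ofFn _ _ j.2]; exact List.mem_cons_self)
      simpa [QFree.holds_ratLe] using this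
    · have := H (QFree.leRat (MPoly.var (2 * q + N + j)) (ratCode (b j))) j j.2
        (by rw [getD_ofFn _ _ j.2, getD_ofFn _ _ j.2]; simp)
      simpa [QFree.holds_leRat] using this
  · intro H G j hj hG
    rw [getD_ofFn _ _ hj, getD_ofFn _ _ hj] at hG
    rcases List.mem_pair.1 hG with rfl | rfl
    · simpa [QFree.holds_ratLe] using (H ⟨j, hj⟩).1
    · simpa [QFree.holds_leRat] using (H ⟨j, hj⟩).2

theorem holds_outputConditions :
    (∀ G ∈ outputConditions p N q, G.Holds v) ↔
      ∀ k : Fin q, v k =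
        ∑ i : Fin N, v (2 * q + N + p + k * N + i) * v (2 * q + i) + v (q + k) := by
  simp only [outputConditions, List.forall_mem_map, List.mem_range, QFree.holds_isZero,
    MPoly.eval_sub, MPoly.eval_append, MPoly.eval_sum, MPoly.eval_var, List.map_map,
    Function.comp_def, MPoly.eval_mul, sub_eq_zero, Fin.forall_iff, sum_map_range]

/-- The exponent of `exp (y_j / d)` in the numerator of `exp (W₁ y + b₁)_i`. -/
def posExponent (d : ℕ) (P : ℤ) (Q : ℕ) : ℕ := d * P.toNat / Q

theorem eval_neuronNum {d : ℕ} (o : ℕ) (P : Fin p → ℤ) (Q : Fin p → ℕ) (r : ℚ) :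
    (neuronNum o p d (List.ofFn fun j => (P j, Q j)) (ratCode r)).eval v =
      r.num * ∏ j : Fin p, v (o + j) ^ posExponent d (P j) (Q j) := by
  rw [neuronNum, MPoly.eval_mul, MPoly.eval_int, MPoly.eval_prod, List.map_map, prod_map_range]
  congr 1
  refine Finset.prod_congr rfl fun j _ => ?_
  simp [posExponent]

theorem eval_neuronDen {d : ℕ} (o : ℕ) (P : Fin p → ℤ) (Q : Fin p → ℕ) (r : ℚ) :
    (neuronDen o p d (List.ofFn fun j => (P j, Q j)) (ratCode r)).eval v =
      r.den * ∏ j : Fin p, v (o + j) ^ posExponent d (-P j) (Q j) := by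
  rw [neuronDen, MPoly.eval_mul, MPoly.eval_nat, MPoly.eval_prod, List.map_map, prod_map_range]
  congr 1
  refine Finset.prod_congr rfl fun j _ => ?_
  simp [posExponent]

theorem posExponent_sub {d Q : ℕ} (P : ℤ) (hQ : 0 < Q) (hd : Q ∣ d) :
    (posExponent d P Q : ℝ) - posExponent d (-P) Q = d * (P / Q : ℝ) := by
  obtain ⟨m, rfl⟩ := hd
  have hQ' : (Q : ℝ) ≠ 0 := by exact_mod_cast hQ.ne'
  have h : ((P.toNat : ℤ) : ℝ) - ((-P).toNat : ℤ) = P := by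
    rw [← Int.cast_sub, Int.toNat_sub_toNat_neg]
  rw [Int.cast_natCast, Int.cast_natCast] at h
  rw [posExponent, posExponent, mul_assoc, mul_assoc, Nat.mul_div_cancel_left _ hQ,
    Nat.mul_div_cancel_left _ hQ, ← h]
  push_cast
  field_simp

theorem sigmoid_eq_of_mul_exp {A t s : ℝ} (hA : 0 < A) :
    s * (A + A * Real.exp t) = A * Real.exp t ↔ s = Real.sigmoid t := by
  have ht := Real.exp_pos t
  rw [Real.sigmoid_def, Real.exp_neg]
  rw [← eq_div_iff (by positivity)]
  have : A * Real.exp t / (A + A * Real.exp t) = (1 + (Real.exp t)⁻¹)⁻¹ := by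
    field_simp
    ring
  rw [this]

theorem holds_neuronConditions {P : Matrix (Fin N) (Fin p) ℤ} {Q : Matrix (Fin N) (Fin p) ℕ}
    (hQ : ∀ i j, 0 < Q i j) {W : Matrix (Fin N) (Fin p) ℝ} (hW : ∀ i j, W i j = P i j / Q i j)
    {b : Fin N → ℝ} {e : Fin N → ℚ} (hb : ∀ i, Real.exp (b i) = e i) {y : Fin p → ℝ}
    (hy : ∀ j : Fin p, v (2 * q + N + j) = Real.exp (y j / denomProd Q)) :
    (∀ G ∈ neuronConditions p N q (List.ofFn fun i => List.ofFn fun j => (P i j, Q i j))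
      (List.ofFn fun i => ratCode (e i)), G.Holds v) ↔
      ∀ i : Fin N, v (2 * q + i) = Real.sigmoid ((W.mulVec y + b) i) := by
  simp only [neuronConditions, List.forall_mem_map, List.mem_range, Fin.forall_iff,
    QFree.holds_isZero, MPoly.eval_sub, MPoly.eval_append, MPoly.eval_mul, sub_eq_zero,
    MPoly.eval_var, codeDenom_ofFn]
  refine forall_congr' fun i => forall_congr' fun hi => ?_
  rw [getD_ofFn _ _ hi, getD_ofFn _ _ hi, eval_neuronNum, eval_neuronDen]
  set i' : Fin N := ⟨i, hi⟩
  have hd : (denomProd Q : ℝ) ≠ 0 := by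
    exact_mod_cast (Finset.prod_pos fun i _ => Finset.prod_pos fun j _ => hQ i j).ne'
  have hden : (0 : ℝ) < (e i').den := by exact_mod_cast (e i').den_pos
  have hA : 0 < ((e i').den : ℝ) * ∏ j : Fin p,
      v (2 * q + N + j) ^ posExponent (denomProd Q) (-P i' j) (Q i' j) :=
    mul_pos hden (Finset.prod_pos fun j _ => pow_pos (by rw [hy]; exact Real.exp_pos _) _)
  rw [← sigmoid_eq_of_mul_exp hA]
  have hnum : ((e i').num : ℝ) = (e i').den * Real.exp (b i') := by
    rw [hb, Rat.cast_def]
    field_simp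
  have hB : ((e i').num : ℝ) * ∏ j : Fin p,
      v (2 * q + N + j) ^ posExponent (denomProd Q) (P i' j) (Q i' j) =
      (((e i').den : ℝ) * ∏ j : Fin p,
        v (2 * q + N + j) ^ posExponent (denomProd Q) (-P i' j) (Q i' j)) *
        Real.exp ((W.mulVec y + b) i') := by
    have : ∏ j : Fin p, v (2 * q + N + j) ^ posExponent (denomProd Q) (P i' j) (Q i' j) =
        (∏ j : Fin p, v (2 * q + N + j) ^ posExponent (denomProd Q) (-P i' j) (Q i' j)) *
          Real.exp (W.mulVec y i') := by
      rw [Matrix.mulVec, dotProduct, Real.exp_sum, ← Finset.prod_mul_distrib]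
      refine Finset.prod_congr rfl fun j _ => ?_
      have hdvd : Q i' j ∣ denomProd Q :=
        (Finset.dvd_prod_of_mem (fun j => Q i' j) (Finset.mem_univ j)).trans
          (Finset.dvd_prod_of_mem (fun i => ∏ j, Q i j) (Finset.mem_univ i'))
      have := posExponent_sub (P i' j) (hQ i' j) hdvd
      rw [← hW] at this
      rw [hy, ← Real.exp_nat_mul, ← Real.exp_nat_mul, ← Real.exp_add]
      congr 1
      rw [← sub_eq_iff_eq_add', ← sub_mul, this]
      field_simp
    rw [this, hnum, Pi.add_apply, Real.exp_add]
    ring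
  rw [hB]

end

/-- The function on `ℕ` that extends `f` by zero. -/
noncomputable def extend {n : ℕ} (f : Fin n → ℝ) (i : ℕ) : ℝ := if h : i < n then f ⟨i, h⟩ else 0

@[simp]
theorem extend_val {n : ℕ} (f : Fin n → ℝ) (i : Fin n) : extend f i = f i := by simp [extend]

/-- An assignment with prescribed values of the groups of variables. -/
theorem exists_assignment {p N q : ℕ} (u b : Fin q → ℝ) (s : Fin N → ℝ) (z : Fin p → ℝ)
    (W : Matrix (Fin q) (Fin N) ℝ) : ∃ f : ℕ → ℝ,
      (∀ k : Fin q, f k = u k) ∧ (∀ k : Fin q, f (q + k) = b k) ∧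
      (∀ i : Fin N, f (2 * q + i) = s i) ∧ (∀ j : Fin p, f (2 * q + N + j) = z j) ∧
      ∀ (k : Fin q) (i : Fin N), f (2 * q + N + p + k * N + i) = W k i := by
  refine ⟨fun n => if n < q then extend u n else if n < 2 * q then extend b (n - q)
    else if n < 2 * q + N then extend s (n - 2 * q)
    else if n < 2 * q + N + p then extend z (n - (2 * q + N))
    else extend (fun k => extend (W k) ((n - (2 * q + N + p)) % N)) ((n - (2 * q + N + p)) / N),
    fun k => ?_, fun k => ?_, fun i => ?_, fun j => ?_, fun k i => ?_⟩
  · simp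
  · have h₁ : q + (k : ℕ) < 2 * q := by omega
    simp [h₁]
  · have h₁ : ¬ 2 * q + (i : ℕ) < q := by omega
    simp [h₁]
  · have h₁ : ¬ 2 * q + N + (j : ℕ) < q := by omega
    have h₂ : ¬ 2 * q + N + (j : ℕ) < 2 * q := by omega
    simp [h₁, h₂]
  · have h₁ : ¬ 2 * q + N + p + k * N + (i : ℕ) < q := by omega
    have h₂ : ¬ 2 * q + N + p + k * N + (i : ℕ) < 2 * q := by omega
    have h₃ : ¬ 2 * q + N + p + k * N + (i : ℕ) < 2 * q + N := by omega
    have h₄ : ¬ 2 * q + N + p + k * N + (i : ℕ) < 2 * q + N + p := by omega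
    have h₅ : 2 * q + N + p + k * N + (i : ℕ) - (2 * q + N + p) = i + N * k := by
      rw [mul_comm N]; omega
    have hN : 0 < N := i.pos
    simp only [h₁, h₂, h₃, h₄, h₅, if_false, Nat.add_mul_mod_self_left, Nat.mod_eq_of_lt i.2,
      Nat.add_mul_div_left _ _ hN, Nat.div_eq_of_lt i.2, zero_add, extend_val]

theorem stack_of_lt {M n : ℕ} (f v : ℕ → ℝ) (h : n < M) : QFree.stack M f v n = f n := if_pos h

end SigmoidVerification

/-- There is one algorithm `D` which, given a sigmoid network with one hidden layer, a box of
inputs `I_y = [α, β]` and an output property `ψ` as in the hypotheses, decides whether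
`(y ∈ I_y ∧ u = h(y)) ⇒ ψ(u)` holds for all `y` and `u`. -/
theorem theorem1 :
    ∃ D : SigmoidVerification.InstanceCode → Bool, Computable D ∧
      ∀ (p N q : ℕ) (h : SigmoidVerification.SigmoidNetwork p N q) (α β : Fin p → ℝ)
        (ψ : SigmoidVerification.RLang.Formula (Fin q))
        (P : Matrix (Fin N) (Fin p) ℤ) (Q : Matrix (Fin N) (Fin p) ℕ)
        (expb₁ : Fin N → ℚ) (expα expβ : Fin p → ℚ)
        (w₂ : Matrix (Fin q) (Fin N) SigmoidVerification.AlgebraicDescription)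
        (c₂ : Fin q → SigmoidVerification.AlgebraicDescription),
        (∀ i j, 0 < Q i j) →
        (∀ i j, h.W₁ i j = (P i j : ℝ) / (Q i j : ℝ)) →
        (∀ i, Real.exp (h.b₁ i) = (expb₁ i : ℝ)) →
        (∀ j, Real.exp (α j / (SigmoidVerification.denomProd Q : ℝ)) = (expα j : ℝ)) →
        (∀ j, Real.exp (β j / (SigmoidVerification.denomProd Q : ℝ)) = (expβ j : ℝ)) →
        (∀ k i, (w₂ k i).Describes (h.W₂ k i)) →
        (∀ k, (c₂ k).Describes (h.b₂ k)) →
        (D (SigmoidVerification.instanceCode P Q expb₁ expα expβ w₂ c₂ ψ) = true ↔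
          ∀ u : Fin q → ℝ, (∃ y ∈ Set.Icc α β, u = h.eval y) → ψ.Realize u) := by
  open SigmoidVerification in
  refine ⟨decideInstance, decideInstance_primrec.to_comp, ?_⟩
  intro p N q h α β ψ P Q expb₁ expα expβ w₂ c₂ hQ hW hb hα hβ hw hc
  have hd : (0 : ℝ) < denomProd Q := by
    exact_mod_cast Finset.prod_pos fun i _ => Finset.prod_pos fun j _ => hQ i j
  have hψ : ∀ v : ℕ → ℝ, (formulaQFree (0, formulaCode ψ)).Holds v ↔
      ψ.Realize fun k => v k := fun v =>
    holds_formulaQFree ψ ⟨fun i => by rw [zero_add], fun k => k.elim0⟩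
  rw [decideInstance, QFree.holdsAtOne_iff, QFree.holds_iterate_all]
  simp only [QFree.holds_foldr_imp, conditions, instanceCode, List.forall_mem_append, hψ,
    holds_biasConditions hc, holds_weightConditions hw, holds_inputConditions,
    holds_outputConditions]
  set M := 2 * q + N + p + q * N with hM
  have hlt : ∀ (k : Fin q) (i : Fin N), 2 * q + N + p + k * N + i < M := fun k i => by
    have := Nat.mul_le_mul_right N (Nat.succ_le_of_lt k.2)
    rw [Nat.succ_mul] at this
    omega
  have heval : ∀ (y : Fin p → ℝ) (k : Fin q), h.eval y k =
      ∑ i, h.W₂ k i * Real.sigmoid ((h.W₁.mulVec y + h.b₁) i) + h.b₂ k := fun y k => rfl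
  constructor
  · rintro H u ⟨y, ⟨hαy, hyβ⟩, rfl⟩
    obtain ⟨f, hfu, hfb, hfs, hfz, hfW⟩ := exists_assignment (h.eval y) h.b₂
      (fun i => Real.sigmoid ((h.W₁.mulVec y + h.b₁) i))
      (fun j => Real.exp (y j / denomProd Q)) h.W₂
    replace hfu : ∀ k : Fin q, QFree.stack M f (fun _ => 1) k = h.eval y k := fun k => by
      rw [stack_of_lt _ _ (by omega), hfu]
    replace hfb : ∀ k : Fin q, QFree.stack M f (fun _ => 1) (q + k) = h.b₂ k := fun k => by
      rw [stack_of_lt _ _ (by omega), hfb]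
    replace hfs : ∀ i : Fin N, QFree.stack M f (fun _ => 1) (2 * q + i) =
        Real.sigmoid ((h.W₁.mulVec y + h.b₁) i) := fun i => by
      rw [stack_of_lt _ _ (by omega), hfs]
    replace hfz : ∀ j : Fin p, QFree.stack M f (fun _ => 1) (2 * q + N + j) =
        Real.exp (y j / denomProd Q) := fun j => by
      rw [stack_of_lt _ _ (by omega), hfz]
    replace hfW : ∀ k i, QFree.stack M f (fun _ => 1) (2 * q + N + p + (k : Fin q) * N +
        (i : Fin N)) = h.W₂ k i := fun k i => by
      rw [stack_of_lt _ _ (hlt k i), hfW]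
    have := H f ⟨hfb, hfW, fun j => ?_, (holds_neuronConditions hQ hW hb hfz).2 hfs, fun k => ?_⟩
    · simpa only [hfu] using this
    · rw [hfz, ← hα, ← hβ, Real.exp_le_exp, Real.exp_le_exp]
      exact ⟨div_le_div_of_nonneg_right (hαy j) hd.le, div_le_div_of_nonneg_right (hyβ j) hd.le⟩
    · simp only [hfu, hfW, hfs, hfb, heval]
  · rintro H f ⟨hfb, hfW, hfz, hfs, hfu⟩
    have hpos : ∀ j : Fin p, 0 < QFree.stack M f (fun _ => 1) (2 * q + N + j) := fun j =>
      (hα j ▸ Real.exp_pos _).trans_le (hfz j).1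
    have hy : ∀ j : Fin p, QFree.stack M f (fun _ => 1) (2 * q + N + j) = Real.exp
        (denomProd Q * Real.log (QFree.stack M f (fun _ => 1) (2 * q + N + j)) / denomProd Q) :=
      fun j => by rw [mul_div_cancel_left₀ _ hd.ne', Real.exp_log (hpos j)]
    have hfs' := (holds_neuronConditions hQ hW hb hy).1 hfs
    refine H _ ⟨fun j => denomProd Q *
      Real.log (QFree.stack M f (fun _ => 1) (2 * q + N + j)), ⟨fun j => ?_, fun j => ?_⟩, ?_⟩
    · have := (hfz j).1
      rw [← hα, hy, Real.exp_le_exp] at this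
      exact (div_le_div_iff_of_pos_right hd).1 this
    · have := (hfz j).2
      rw [← hβ, hy, Real.exp_le_exp] at this
      exact (div_le_div_iff_of_pos_right hd).1 this
    · funext k
      rw [hfu, heval]
      simp only [hfW, hfs', hfb]
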